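/- Fix sets of participants $p,q$, labels $\ell$, payload types $b$ and type variables $X$. \emph{Session types} are generated by $$T ::= \mathsf{end} \mid p\oplus\{\ell_i(b_i).T_i\}_{i\in I} \mid p\,\&\,\{\ell_i(b_i).T_i\}_{i\in I} \mid X \mid \mu X.T,$$ where in the internal choice $\oplus$ and the external choice $\&$ the index set $I$ is finite and non-empty and the labels $\ell_i$ are pairwise distinct, and where in $\mu X.T$ (which binds $X$) every occurrence of $X$ in $T$ is inside a choice. Session types are taken up to renaming of bound variables and of indices; $T$ is \emph{over} a set $\Theta$ of variables if all its free variables lie in $\Theta$. Substitution $T[\dots]$ is capture-avoiding. The unfolding is $\mathrm{unf}(\mu X.T)=\mathrm{unf}(T)[X\mapsto\mu X.T]$, and $\mathrm{unf}(T)=T$ if $T$ is not of the form $\mu X.T'$. The relation $U\xrightarrow{p!\ell(b)}U'$ is defined inductively by the following rules. \begin{itemize} \item $p\oplus\{\ell_i(b_i).U_i\}_{i\in I}\xrightarrow{p!\ell_i(b_i)}U_i$ for $i\in I$. \item If $p\ne q$, $\emptyset\neq J\subseteq I$ and $U_i\xrightarrow{p!\ell(b)}U_i'$ for all $i\in J$,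 then $q\oplus\{\ell'_i(b'_i).U_i\}_{i\in I}\xrightarrow{p!\ell(b)}q\oplus\{\ell'_i(b'_i).U'_i\}_{i\in J}$. \item If $U_i\xrightarrow{p!\ell(b)}U_i'$ for all $i\in I$, then $q\,\&\,\{\ell'_i(b'_i).U_i\}_{i\in I}\xrightarrow{p!\ell(b)}q\,\&\,\{\ell'_i(b'_i).U'_i\}_{i\in I}$ (here $q=p$ is allowed). \item If $U[X\mapsto\mu X.U]\xrightarrow{p!\ell(b)}U'$, then $\mu X.U\xrightarrow{p!\ell(b)}U'$. \end{itemize} The predicate $\mathrm{Sends}_p$ is defined inductively: it holds of $p\oplus\{\ell_i(b_i).T_i\}_{i\in I}$; it holds of $q\oplus\{\ell_i(b_i).T_i\}_{i\in I}$ if it holds of all $T_i$; it holds of $\mu X.T$ if it holds of $T$. The relation $T\xrightarrow{p?\ell(b)}T'$ and the predicate $\mathrm{Recvs}_p$ are defined by the same rules with $\oplus$ and $\&$ exchanged. \emph{Asynchronous subtyping} $<:_\Theta$ is the largest relation between session types over $\Theta$ such that $T<:_\Theta U$ implies: \begin{enumerate} \item if $\mathrm{unf}(T)=p\oplus\{\ell_i(b_i).T_i\}_{i\in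 I}$, then for every $i\in I$ there is $U_i$ with $U\xrightarrow{p!\ell_i(b_i)}U_i$ and $T_i<:_\Theta U_i$; \item if $\mathrm{unf}(T)=p\,\&\,\{\ell_i(b_i).T_i\}_{i\in I}$, then $\mathrm{Recvs}_p(U)$; \item if $\mathrm{unf}(U)=p\oplus\{\ell_i(b_i).U_i\}_{i\in I}$, then $\mathrm{Sends}_p(T)$; \item if $\mathrm{unf}(U)=p\,\&\,\{\ell_i(b_i).U_i\}_{i\in I}$, then for every $i\in I$ there is $T_i$ with $T\xrightarrow{p?\ell_i(b_i)}T_i$ and $T_i<:_\Theta U_i$; \item for every $X\in\Theta$: $\mathrm{unf}(T)=X$ if and only if $\mathrm{unf}(U)=X$. \end{enumerate} \textbf{Lemma.} For every set $\Theta$ of type variables: \begin{itemize} \item $T<:_\Theta T$ for every session type $T$ over $\Theta$. \item If $S<:_\Theta T$ and $T<:_\Theta U$, then $S<:_\Theta U$. \item If $\emptyset\ne J\subseteq I$, all $U_i$ ($i\in I$) are session types over $\Theta$, and $T_i<:_\Theta U_i$ for all $i\in J$, then $p\oplus\{\ell_i(b_i).T_i\}_{i\in J}<:_\Theta p\oplus\{\ell_i(b_i).U_i\}_{i\in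 I}$. \item If $\emptyset\ne J\subseteq I$, all $T_i$ ($i\in I$) are session types over $\Theta$, and $T_i<:_\Theta U_i$ for all $i\in J$, then $p\,\&\,\{\ell_i(b_i).T_i\}_{i\in I}<:_\Theta p\,\&\,\{\ell_i(b_i).U_i\}_{i\in J}$. \item If $X\notin\Theta$, $T<:_{\Theta\cup\{X\}}U$, and $X$ occurs in $T$ and in $U$ only inside choices, then $\mu X.T<:_\Theta\mu X.U$. \item If $\Xi$ is a set of type variables, $T<:_{\Xi}U$, and $T_X<:_\Theta U_X$ for all $X\in\Xi$, then $T[X\mapsto T_X]_{X\in\Xi}<:_\Theta U[X\mapsto U_X]_{X\in\Xi}$ (simultaneous substitution). In particular this holds for $\Xi=\{X_1,\dots,X_n\}$. \end{itemize} -/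

import Mathlib

universe u v

/-- Raw session types over a set `Θ` of type variables, up to renaming of bound variables:
the body of a recursive type lives over `Option Θ`, where `none` is the variable being bound.
A choice carries a finite non-empty set `I` of labels, so that the labels of its branches are
distinct; the branch with label `i` has payload type `b i` and continuation `T i`. -/
inductive SType (Role Label Base : Type v) : Type u → Type (max (u + 1) v)
  | fin {Θ : Type u} : SType Role Label Base Θ
  | send {Θ : Type u} (p : Role) (I : Finset Label) (hI : I.Nonempty) (b : I → Base)
      (T : I → SType Role Label Base Θ) : SType Role Label Base Θ
  | recv {Θ : Type u} (p : Role) (I : Finset Label) (hI : I.Nonempty) (b : I → Base)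
      (T : I → SType Role Label Base Θ) : SType Role Label Base Θ
  | var {Θ : Type u} (X : Θ) : SType Role Label Base Θ
  | mu {Θ : Type u} (T : SType Role Label Base (Option Θ)) : SType Role Label Base Θ

namespace SType

variable {Role Label Base : Type v}

/-- Renaming of free variables. -/
def rename {Θ : Type u} (T : SType Role Label Base Θ) :
    {Θ' : Type u} → (Θ → Θ') → SType Role Label Base Θ' :=
  match T with
  | fin => fun _ => fin
  | send p I hI b T => fun f => send p I hI b (fun i => (T i).rename f)
  | recv p I hI b T => fun f => recv p I hI b (fun i => (T i).rename f)
  | var X => fun f => var (f X)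
  | mu T => fun f => mu (T.rename (Option.map f))

/-- A substitution, extended to leave the newly bound variable alone. -/
def lift {Θ Θ' : Type u} (σ : Θ → SType Role Label Base Θ') :
    Option Θ → SType Role Label Base (Option Θ')
  | none => var none
  | some X => (σ X).rename some

/-- Simultaneous capture-avoiding substitution. -/
def subst {Θ : Type u} (T : SType Role Label Base Θ) :
    {Θ' : Type u} → (Θ → SType Role Label Base Θ') → SType Role Label Base Θ' :=
  match T with
  | fin => fun _ => fin
  | send p I hI b T => fun σ => send p I hI b (fun i => (T i).subst σ)
  | recv p I hI b T => fun σ => recv p I hI b (fun i => (T i).subst σ)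
  | var X => fun σ => σ X
  | mu T => fun σ => mu (T.subst (lift σ))

/-- `T[X ↦ S]`, where `X` is the most recently bound variable. -/
def inst {Θ : Type u} (T : SType Role Label Base (Option Θ)) (S : SType Role Label Base Θ) :
    SType Role Label Base Θ :=
  T.subst (fun o => o.elim S var)

/-- Every free occurrence of `X` in `T` is inside an internal or external choice. -/
def GuardedIn {Θ : Type u} (T : SType Role Label Base Θ) : Θ → Prop :=
  match T with
  | fin => fun _ => True
  | send _ _ _ _ _ => fun _ => True
  | recv _ _ _ _ _ => fun _ => True
  | var Y => fun X => Y ≠ X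
  | mu T => fun X => T.GuardedIn (some X)

/-- All recursion is guarded: the raw type is a session type. -/
def WF {Θ : Type u} (T : SType Role Label Base Θ) : Prop :=
  match T with
  | fin => True
  | send _ _ _ _ T => ∀ i, (T i).WF
  | recv _ _ _ _ T => ∀ i, (T i).WF
  | var _ => True
  | mu T => T.GuardedIn none ∧ T.WF

/-- Unfolding. -/
def unfold {Θ : Type u} (T : SType Role Label Base Θ) : SType Role Label Base Θ :=
  match T with
  | fin => fin
  | send p I hI b T => send p I hI b T
  | recv p I hI b T => recv p I hI b T
  | var X => var X
  | mu T => T.unfold.inst (mu T)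

/-- `RedSend p ℓ b U U'`: an implementation of `U` may send to `p` a message with label `ℓ` and
payload type `b`, and then follow `U'`. -/
inductive RedSend (p : Role) (ℓ : Label) (b : Base) {Θ : Type u} :
    SType Role Label Base Θ → SType Role Label Base Θ → Prop
  | base (I : Finset Label) (hI : I.Nonempty) (c : I → Base)
      (U : I → SType Role Label Base Θ) (hℓ : ℓ ∈ I) (hb : c ⟨ℓ, hℓ⟩ = b) :
      RedSend p ℓ b (send p I hI c U) (U ⟨ℓ, hℓ⟩)
  | send (q : Role) (hpq : p ≠ q) (I J : Finset Label) (hI : I.Nonempty) (hJ : J.Nonempty)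
      (hJI : J ⊆ I) (c : I → Base) (U : I → SType Role Label Base Θ)
      (U' : J → SType Role Label Base Θ)
      (h : ∀ i : J, RedSend p ℓ b (U ⟨i, hJI i.2⟩) (U' i)) :
      RedSend p ℓ b (send q I hI c U) (send q J hJ (fun i => c ⟨i, hJI i.2⟩) U')
  | recv (q : Role) (I : Finset Label) (hI : I.Nonempty) (c : I → Base)
      (U U' : I → SType Role Label Base Θ) (h : ∀ i, RedSend p ℓ b (U i) (U' i)) :
      RedSend p ℓ b (recv q I hI c U) (recv q I hI c U')
  | mu (U : SType Role Label Base (Option Θ)) (U' : SType Role Label Base Θ)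
      (h : RedSend p ℓ b (U.inst (mu U)) U') : RedSend p ℓ b (mu U) U'

/-- `RedRecv p ℓ b T T'`: an implementation of `T` must accept from `p` a message with label `ℓ`
and payload type `b`, and then follow `T'`. -/
inductive RedRecv (p : Role) (ℓ : Label) (b : Base) {Θ : Type u} :
    SType Role Label Base Θ → SType Role Label Base Θ → Prop
  | base (I : Finset Label) (hI : I.Nonempty) (c : I → Base)
      (T : I → SType Role Label Base Θ) (hℓ : ℓ ∈ I) (hb : c ⟨ℓ, hℓ⟩ = b) :
      RedRecv p ℓ b (recv p I hI c T) (T ⟨ℓ, hℓ⟩)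
  | recv (q : Role) (hpq : p ≠ q) (I J : Finset Label) (hI : I.Nonempty) (hJ : J.Nonempty)
      (hJI : J ⊆ I) (c : I → Base) (T : I → SType Role Label Base Θ)
      (T' : J → SType Role Label Base Θ)
      (h : ∀ i : J, RedRecv p ℓ b (T ⟨i, hJI i.2⟩) (T' i)) :
      RedRecv p ℓ b (recv q I hI c T) (recv q J hJ (fun i => c ⟨i, hJI i.2⟩) T')
  | send (q : Role) (I : Finset Label) (hI : I.Nonempty) (c : I → Base)
      (T T' : I → SType Role Label Base Θ) (h : ∀ i, RedRecv p ℓ b (T i) (T' i)) :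
      RedRecv p ℓ b (send q I hI c T) (send q I hI c T')
  | mu (T : SType Role Label Base (Option Θ)) (T' : SType Role Label Base Θ)
      (h : RedRecv p ℓ b (T.inst (mu T)) T') : RedRecv p ℓ b (mu T) T'

/-- An implementation must send a message to `p`, without waiting for any message before. -/
inductive Sends (p : Role) : {Θ : Type u} → SType Role Label Base Θ → Prop
  | base {Θ : Type u} (I : Finset Label) (hI : I.Nonempty) (b : I → Base)
      (T : I → SType Role Label Base Θ) : Sends p (send p I hI b T)
  | send {Θ : Type u} (q : Role) (I : Finset Label) (hI : I.Nonempty) (b : I → Base)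
      (T : I → SType Role Label Base Θ) (h : ∀ i, Sends p (T i)) : Sends p (send q I hI b T)
  | mu {Θ : Type u} (T : SType Role Label Base (Option Θ)) (h : Sends p T) : Sends p (mu T)

/-- An implementation may wait for a message from `p`, without sending any message before. -/
inductive Recvs (p : Role) : {Θ : Type u} → SType Role Label Base Θ → Prop
  | base {Θ : Type u} (I : Finset Label) (hI : I.Nonempty) (b : I → Base)
      (U : I → SType Role Label Base Θ) : Recvs p (recv p I hI b U)
  | recv {Θ : Type u} (q : Role) (I : Finset Label) (hI : I.Nonempty) (b : I → Base)
      (U : I → SType Role Label Base Θ) (h : ∀ i, Recvs p (U i)) : Recvs p (recv q I hI b U)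
  | mu {Θ : Type u} (U : SType Role Label Base (Option Θ)) (h : Recvs p U) : Recvs p (mu U)

/-- The closure conditions of asynchronous subtyping, for a relation between session types
over `Θ`. -/
structure IsSimulation {Θ : Type u}
    (R : SType Role Label Base Θ → SType Role Label Base Θ → Prop) : Prop where
  wf : ∀ T U, R T U → T.WF ∧ U.WF
  left_send : ∀ T U, R T U → ∀ p I hI b T', T.unfold = send p I hI b T' →
    ∀ i : I, ∃ U', RedSend p i.1 (b i) U U' ∧ R (T' i) U'
  left_recv : ∀ T U, R T U → ∀ p I hI b T', T.unfold = recv p I hI b T' → Recvs p U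
  right_send : ∀ T U, R T U → ∀ p I hI b U', U.unfold = send p I hI b U' → Sends p T
  right_recv : ∀ T U, R T U → ∀ p I hI b U', U.unfold = recv p I hI b U' →
    ∀ i : I, ∃ T', RedRecv p i.1 (b i) T T' ∧ R T' (U' i)
  vars : ∀ T U, R T U → ∀ X : Θ, T.unfold = var X ↔ U.unfold = var X

/-- Asynchronous subtyping: the largest relation satisfying the conditions, as the union of all
of them. -/
def Sub {Θ : Type u} (T U : SType Role Label Base Θ) : Prop :=
  ∃ R : SType Role Label Base Θ → SType Role Label Base Θ → Prop, IsSimulation R ∧ R T U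

/-- The recursive type `μX.T` over a set `Θ` of named variables, for `T` over `Θ, X`. -/
noncomputable def muVar {V : Type u} {Θ : Set V} (X : V)
    (T : SType Role Label Base ↥(insert X Θ)) : SType Role Label Base ↥Θ :=
  open Classical in
  mu (T.rename fun Y => if h : Y.1 = X then none else some ⟨Y.1, Y.2.resolve_left h⟩)

end SType

/-!
Sending and receiving, `⊕` and `&`, and the two sides of `<:` are mirror images of each other, so
every argument is made once, for a polarity and its dual. All rules look through unfoldings and
therefore depend only on the head of the unfolding of a type. Taking heads commutes with
substitution, and `μX.T` and `T[X ↦ μX.T]` have the same head.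

Transitivity rests on transferring reductions: if `T <: U` and `T` reduces to `T'` by sending, then
`U` reduces to some `U'` with `T' <: U'`. The proof is by induction on the reduction of `T`. Below
an internal choice of `T`, each branch is matched by a reduction of `U`, which the induction
hypothesis continues by the given message; these reductions of `U` can be exchanged so that this
message comes first and leads to one common `U'`. Below an external choice of `T` with `q`, the type
`U` is a finite tree of external choices with one with `q` on every path, and one descends into this
tree: whatever the root of `U` receives, `T` can receive as well, and this reception commutes with
the reduction to `T'`.

For substitution, `T[σ]` and `U[τ]` inherit the closure conditions from `T` and `U` unless the heads
of `T` and `U` are variables, in which case the conditions are those on `σ X` and `τ X`. The latter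
may circularly be a pair of the same form, which gives recursion with `σ X = μX.T` and `τ X = μX.U`.
-/

namespace SType

variable {Role Label Base : Type v} {Θ Θ₁ Θ₂ : Type u}

/-! ### Renaming and substitution -/

theorem rename_rename (T : SType Role Label Base Θ) {Θ₁ Θ₂ : Type u} (f : Θ → Θ₁) (g : Θ₁ → Θ₂) :
    (T.rename f).rename g = T.rename (g ∘ f) := by
  induction T generalizing Θ₁ Θ₂ with
  | fin | var X => rfl
  | send p I hI b T ih | recv p I hI b T ih => simp only [rename, ih]
  | mu T ih => simp only [rename, ih, Option.map_comp_map]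

theorem lift_comp_map (f : Θ → Θ₁) (σ : Θ₁ → SType Role Label Base Θ₂) :
    lift σ ∘ Option.map f = lift (σ ∘ f) := by
  funext o; cases o <;> rfl

theorem subst_rename (T : SType Role Label Base Θ) {Θ₁ Θ₂ : Type u} (f : Θ → Θ₁)
    (σ : Θ₁ → SType Role Label Base Θ₂) : (T.rename f).subst σ = T.subst (σ ∘ f) := by
  induction T generalizing Θ₁ Θ₂ with
  | fin | var X => rfl
  | send p I hI b T ih | recv p I hI b T ih => simp only [rename, subst, ih]
  | mu T ih => simp only [rename, subst, ih, lift_comp_map]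

theorem rename_map_lift (σ : Θ → SType Role Label Base Θ₁) (f : Θ₁ → Θ₂) :
    (fun o => (lift σ o).rename (Option.map f)) = lift (fun X => (σ X).rename f) := by
  funext o
  cases o with
  | none => rfl
  | some X => simp only [lift, rename_rename, Option.map_comp_some]

theorem rename_subst (T : SType Role Label Base Θ) {Θ₁ Θ₂ : Type u}
    (σ : Θ → SType Role Label Base Θ₁) (f : Θ₁ → Θ₂) :
    (T.subst σ).rename f = T.subst (fun X => (σ X).rename f) := by
  induction T generalizing Θ₁ Θ₂ with
  | fin | var X => rfl
  | send p I hI b T ih | recv p I hI b T ih => simp only [rename, subst, ih]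
  | mu T ih => simp only [rename, subst, ih, rename_map_lift]

theorem subst_lift_lift (σ : Θ → SType Role Label Base Θ₁) (τ : Θ₁ → SType Role Label Base Θ₂) :
    (fun o => (lift σ o).subst (lift τ)) = lift (fun X => (σ X).subst τ) := by
  funext o
  cases o with
  | none => rfl
  | some X => simp only [lift, subst_rename, rename_subst, Function.comp_def]

theorem subst_subst (T : SType Role Label Base Θ) {Θ₁ Θ₂ : Type u}
    (σ : Θ → SType Role Label Base Θ₁) (τ : Θ₁ → SType Role Label Base Θ₂) :
    (T.subst σ).subst τ = T.subst (fun X => (σ X).subst τ) := by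
  induction T generalizing Θ₁ Θ₂ with
  | fin | var X => rfl
  | send p I hI b T ih | recv p I hI b T ih => simp only [subst, ih]
  | mu T ih => simp only [subst, ih, subst_lift_lift]

theorem lift_var : lift (var : Θ → SType Role Label Base Θ) = var := by
  funext o; cases o <;> rfl

theorem subst_var (T : SType Role Label Base Θ) : T.subst var = T := by
  induction T with
  | fin | var X => rfl
  | send p I hI b T ih | recv p I hI b T ih => simp only [subst, ih]
  | mu T ih => simp only [subst, lift_var, ih]

theorem rename_eq_subst (T : SType Role Label Base Θ) (f : Θ → Θ₁) :
    T.rename f = T.subst (var ∘ f) := by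
  rw [← subst_rename, subst_var]

theorem inst_rename_some (T S : SType Role Label Base Θ) : (T.rename some).inst S = T :=
  (subst_rename T some _).trans (subst_var T)

theorem inst_subst_lift (T : SType Role Label Base (Option Θ)) (σ : Θ → SType Role Label Base Θ₁)
    (S : SType Role Label Base Θ₁) :
    (T.subst (lift σ)).inst S = T.subst (fun o => o.elim S σ) := by
  rw [inst, subst_subst]
  congr 1
  funext o
  cases o with
  | none => rfl
  | some X => exact inst_rename_some _ _

theorem subst_inst (T : SType Role Label Base (Option Θ)) (S : SType Role Label Base Θ)
    (σ : Θ → SType Role Label Base Θ₁) :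
    (T.inst S).subst σ = T.subst (fun o => o.elim (S.subst σ) σ) := by
  rw [inst, subst_subst]
  congr 1
  funext o
  cases o <;> rfl

/-! ### Well-formedness -/

theorem GuardedIn.rename {T : SType Role Label Base Θ} {Θ₁ : Type u} {f : Θ → Θ₁} {Y : Θ₁}
    (h : ∀ X, f X = Y → T.GuardedIn X) : (T.rename f).GuardedIn Y := by
  induction T generalizing Θ₁ with
  | fin | send | recv => trivial
  | var X => exact fun hXY => h X hXY rfl
  | mu T ih =>
    refine ih fun o ho => ?_
    cases o with
    | none => cases ho
    | some X => exact h X (Option.some.inj ho)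

theorem GuardedIn.rename_some_none (T : SType Role Label Base Θ) :
    (T.rename some).GuardedIn none :=
  .rename fun X hX => (Option.some_ne_none X hX).elim

theorem GuardedIn.subst {T : SType Role Label Base Θ} {Θ₁ : Type u}
    {σ : Θ → SType Role Label Base Θ₁} {Y : Θ₁}
    (h : ∀ X, T.GuardedIn X ∨ (σ X).GuardedIn Y) : (T.subst σ).GuardedIn Y := by
  induction T generalizing Θ₁ with
  | fin | send | recv => trivial
  | var X => exact (h X).resolve_left fun hX => hX rfl
  | mu T ih =>
    refine ih fun o => ?_
    cases o with
    | none => exact Or.inr (Option.some_ne_none Y).symm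
    | some X =>
      exact (h X).imp_right fun hX => .rename fun Z hZ => Option.some.inj hZ ▸ hX

theorem WF.rename {T : SType Role Label Base Θ} (hT : T.WF) {Θ₁ : Type u} (f : Θ → Θ₁) :
    (T.rename f).WF := by
  induction T generalizing Θ₁ with
  | fin | var => trivial
  | send p I hI b T ih | recv p I hI b T ih => exact fun i => ih i (hT i) f
  | mu T ih =>
    refine ⟨GuardedIn.rename fun o ho => ?_, ih hT.2 _⟩
    cases o with
    | none => exact hT.1
    | some X => cases ho

theorem WF.subst {T : SType Role Label Base Θ} (hT : T.WF) {Θ₁ : Type u}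
    {σ : Θ → SType Role Label Base Θ₁} (hσ : ∀ X, (σ X).WF) : (T.subst σ).WF := by
  induction T generalizing Θ₁ with
  | fin => trivial
  | var X => exact hσ X
  | send p I hI b T ih | recv p I hI b T ih => exact fun i => ih i (hT i) hσ
  | mu T ih =>
    refine ⟨GuardedIn.subst fun o => ?_, ih hT.2 fun o => ?_⟩ <;> cases o with
    | none => first | exact Or.inl hT.1 | trivial
    | some X => first | exact Or.inr (.rename_some_none _) | exact (hσ X).rename some

theorem WF.unfold {T : SType Role Label Base Θ} (hT : T.WF) : T.unfold.WF := by
  induction T with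
  | mu T ih =>
    refine (ih hT.2).subst fun o => ?_
    cases o with
    | none => exact hT
    | some X => trivial
  | _ => exact hT

/-! ### Polarities and heads -/

/-- The two kinds of choices: internal (`send`) and external (`recv`). Indexing by a polarity lets
every notion and its mirror image share one definition. -/
inductive Polarity
  | send
  | recv

namespace Polarity

/-- The opposite polarity. -/
def dual : Polarity → Polarity
  | send => recv
  | recv => send

@[simp] theorem dual_dual (s : Polarity) : s.dual.dual = s := by cases s <;> rfl

theorem dual_ne (s : Polarity) : s.dual ≠ s := by cases s <;> nofun

theorem eq_dual_of_ne {s s' : Polarity} (h : s' ≠ s) : s' = s.dual := by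
  cases s <;> cases s' <;> first | rfl | exact absurd rfl h

end Polarity

/-- A choice of the given polarity. -/
def choice (s : Polarity) (p : Role) (I : Finset Label) (hI : I.Nonempty) (b : I → Base)
    (T : I → SType Role Label Base Θ) : SType Role Label Base Θ :=
  match s with
  | .send => send p I hI b T
  | .recv => recv p I hI b T

theorem choice_subst (s : Polarity) (p : Role) (I : Finset Label) (hI : I.Nonempty)
    (b : I → Base) (T : I → SType Role Label Base Θ) (σ : Θ → SType Role Label Base Θ₁) :
    (choice s p I hI b T).subst σ = choice s p I hI b (fun i => (T i).subst σ) := by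
  cases s <;> rfl

theorem wf_choice {s : Polarity} {p : Role} {I : Finset Label} {hI : I.Nonempty}
    {b : I → Base} {T : I → SType Role Label Base Θ} :
    (choice s p I hI b T).WF ↔ ∀ i, (T i).WF := by
  cases s <;> rfl

/-- The outermost constructor of a type that is not recursive, with internal and external choices
treated uniformly. -/
inductive Head (Role Label Base : Type v) (Θ : Type u) : Type (max (u + 1) v)
  | fin
  | var (X : Θ)
  | choice (s : Polarity) (p : Role) (I : Finset Label) (hI : I.Nonempty) (b : I → Base)
      (T : I → SType Role Label Base Θ)

/-- Substitution in a head: `σ` is applied to the branches of a choice, and `v` to a variable at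
the top. The two differ because the head of a substituted type may have to be unfolded first. -/
def Head.bind (σ : Θ → SType Role Label Base Θ₁) (v : Θ → Head Role Label Base Θ₁) :
    Head Role Label Base Θ → Head Role Label Base Θ₁
  | .fin => .fin
  | .var X => v X
  | .choice s p I hI b T => .choice s p I hI b (fun i => (T i).subst σ)

theorem Head.bind_bind (H : Head Role Label Base Θ) (σ : Θ → SType Role Label Base Θ₁)
    (v : Θ → Head Role Label Base Θ₁) (τ : Θ₁ → SType Role Label Base Θ₂)
    (w : Θ₁ → Head Role Label Base Θ₂) :
    (H.bind σ v).bind τ w = H.bind (fun X => (σ X).subst τ) (fun X => (v X).bind τ w) := by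
  cases H <;> simp only [Head.bind, subst_subst]

theorem Head.bind_var (H : Head Role Label Base Θ) : H.bind SType.var .var = H := by
  cases H <;> simp only [Head.bind, subst_var]

/-- The head of a type that is not recursive. A recursive type gets the junk value `fin`; among
unfoldings this only happens for unguarded types such as `μX.X`. -/
def head (T : SType Role Label Base Θ) : Head Role Label Base Θ :=
  match T with
  | fin => .fin
  | send p I hI b T => .choice .send p I hI b T
  | recv p I hI b T => .choice .recv p I hI b T
  | var X => .var X
  | mu _ => .fin

/-- The head of the unfolding. -/
def out (T : SType Role Label Base Θ) : Head Role Label Base Θ := T.unfold.head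

theorem head_subst (T : SType Role Label Base Θ) (σ : Θ → SType Role Label Base Θ₁) :
    (T.subst σ).head = T.head.bind σ fun X => (σ X).head := by
  cases T <;> rfl

theorem out_mu (T : SType Role Label Base (Option Θ)) :
    (mu T).out = T.out.bind (fun o => o.elim (mu T) var) fun o => o.elim .fin .var := by
  rw [out, unfold, inst, head_subst]
  congr 1
  funext o
  cases o <;> rfl

theorem out_rename (T : SType Role Label Base Θ) {Θ₁ : Type u} (f : Θ → Θ₁) :
    (T.rename f).out = T.out.bind (var ∘ f) (.var ∘ f) := by
  induction T generalizing Θ₁ with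
  | fin | var X => rfl
  | send p I hI b T _ | recv p I hI b T _ =>
    simp only [rename, out, unfold, head, Head.bind, rename_eq_subst]
  | mu T ih =>
    rw [rename, out_mu, ih, out_mu, Head.bind_bind, Head.bind_bind]
    congr 1 <;> funext o
    · cases o with
      | none => exact rename_eq_subst (mu T) f
      | some X => rfl
    · cases o <;> rfl

theorem out_subst (T : SType Role Label Base Θ) {Θ₁ : Type u} (σ : Θ → SType Role Label Base Θ₁) :
    (T.subst σ).out = T.out.bind σ fun X => (σ X).out := by
  induction T generalizing Θ₁ with
  | fin | var X | send | recv => rfl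
  | mu T ih =>
    rw [subst, out_mu, ih, out_mu, Head.bind_bind, Head.bind_bind]
    congr 1 <;> funext o
    · cases o with
      | none => rfl
      | some X => exact inst_rename_some _ _
    · cases o with
      | none => rfl
      | some X =>
        change ((σ X).rename some).out.bind _ _ = (σ X).out
        rw [out_rename, Head.bind_bind]
        exact Head.bind_var _

theorem out_inst_mu (T : SType Role Label Base (Option Θ)) : (T.inst (mu T)).out = (mu T).out := by
  rw [inst, out_subst]
  cases hT : T.out with
  | fin | choice => rw [out_mu, hT]; rfl
  | var o => cases o with
    | none => rfl
    | some X => rw [out_mu, hT]; rfl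

section OutChoice

variable {s : Polarity} {p : Role} {I : Finset Label} {hI : I.Nonempty} {b : I → Base}

@[simp] theorem out_choice (s : Polarity) (p : Role) (I : Finset Label) (hI : I.Nonempty)
    (b : I → Base) (T : I → SType Role Label Base Θ) :
    (choice s p I hI b T).out = .choice s p I hI b T := by
  cases s <;> rfl

theorem head_eq_choice {T : SType Role Label Base Θ} {V : I → SType Role Label Base Θ} :
    T.head = .choice s p I hI b V ↔ T = choice s p I hI b V := by
  constructor
  · intro h
    cases T <;> cases h <;> rfl
  · rintro rfl
    cases s <;> rfl

theorem head_eq_var {T : SType Role Label Base Θ} {X : Θ} : T.head = .var X ↔ T = var X := by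
  constructor
  · intro h
    cases T <;> cases h
    rfl
  · rintro rfl
    rfl

theorem out_subst_of_choice {T : SType Role Label Base Θ} {V : I → SType Role Label Base Θ}
    (hT : T.out = .choice s p I hI b V) (σ : Θ → SType Role Label Base Θ₁) :
    (T.subst σ).out = .choice s p I hI b (fun i => (V i).subst σ) := by
  rw [out_subst, hT, Head.bind]

theorem out_subst_of_var {T : SType Role Label Base Θ} {X : Θ} (hT : T.out = .var X)
    (σ : Θ → SType Role Label Base Θ₁) : (T.subst σ).out = (σ X).out := by
  rw [out_subst, hT, Head.bind]

theorem exists_out_eq_of_out_subst_eq_choice {T : SType Role Label Base Θ}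
    {σ : Θ → SType Role Label Base Θ₁} {V : I → SType Role Label Base Θ₁}
    (hT : ∀ X, T.out ≠ .var X) (h : (T.subst σ).out = .choice s p I hI b V) :
    ∃ V', T.out = .choice s p I hI b V' ∧ V = fun i => (V' i).subst σ := by
  rw [out_subst] at h
  cases hout : T.out with
  | fin => rw [hout] at h; cases h
  | var X => exact absurd hout (hT X)
  | choice s p I hI b V' => rw [hout] at h; cases h; exact ⟨V', rfl, rfl⟩

theorem out_subst_ne_var {T : SType Role Label Base Θ} (hT : ∀ X, T.out ≠ .var X)
    (σ : Θ → SType Role Label Base Θ₁) (Y : Θ₁) : (T.subst σ).out ≠ .var Y := by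
  rw [out_subst]
  cases hout : T.out with
  | var X => exact absurd hout (hT X)
  | fin | choice => nofun

theorem WF.of_out {T : SType Role Label Base Θ} (hT : T.WF) {V : I → SType Role Label Base Θ}
    (h : T.out = .choice s p I hI b V) (i : I) : (V i).WF := by
  have hunf := hT.unfold
  rw [head_eq_choice.1 h, wf_choice] at hunf
  exact hunf i

end OutChoice

theorem subst_of_subst_unfold {P : SType Role Label Base Θ₁ → Prop}
    (hP : ∀ T, P (T.inst (mu T)) → P (mu T)) (T : SType Role Label Base Θ)
    (σ : Θ → SType Role Label Base Θ₁) (h : P (T.unfold.subst σ)) : P (T.subst σ) := by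
  induction T with
  | mu T ih =>
    refine hP _ ?_
    rw [unfold, subst_inst] at h
    rw [inst_subst_lift]
    exact ih _ h
  | _ => exact h

theorem of_unfold {P : SType Role Label Base Θ → Prop} (hP : ∀ T, P (T.inst (mu T)) → P (mu T))
    {T : SType Role Label Base Θ} (h : P T.unfold) : P T := by
  rw [← subst_var T]
  refine subst_of_subst_unfold hP T var ?_
  rwa [subst_var]

/-! ### Reductions through heads -/

variable {s s' : Polarity} {p q : Role} {ℓ ℓ' : Label} {b b' : Base} {n : ℕ}

/-- The rules defining reductions of polarity `s`, read off the heads of unfoldings, with `R` in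
place of the reductions of the branches. -/
inductive RedStep (s : Polarity) (p : Role) (ℓ : Label) (b : Base)
    (R : SType Role Label Base Θ → SType Role Label Base Θ → Prop) (U : SType Role Label Base Θ) :
    SType Role Label Base Θ → Prop
  | base {I : Finset Label} {hI : I.Nonempty} {c : I → Base} {V : I → SType Role Label Base Θ}
      (hU : U.out = .choice s p I hI c V) (hℓ : ℓ ∈ I) (hb : c ⟨ℓ, hℓ⟩ = b) :
      RedStep s p ℓ b R U (V ⟨ℓ, hℓ⟩)
  | same {q : Role} {I : Finset Label} {hI : I.Nonempty} {c : I → Base}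
      {V : I → SType Role Label Base Θ} (hU : U.out = .choice s q I hI c V) (hpq : p ≠ q)
      (J : Finset Label) (hJ : J.Nonempty) (hJI : J ⊆ I) (V' : J → SType Role Label Base Θ)
      (h : ∀ i : J, R (V ⟨i, hJI i.2⟩) (V' i)) :
      RedStep s p ℓ b R U (choice s q J hJ (fun i => c ⟨i, hJI i.2⟩) V')
  | opposite {s' : Polarity} {q : Role} {I : Finset Label} {hI : I.Nonempty} {c : I → Base}
      {V : I → SType Role Label Base Θ} (hU : U.out = .choice s' q I hI c V) (hs : s' ≠ s)
      (V' : I → SType Role Label Base Θ) (h : ∀ i, R (V i) (V' i)) :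
      RedStep s p ℓ b R U (choice s' q I hI c V')

/-- Reductions with a derivation of height at most `n`. The explicit height allows induction on
several reductions of one type at once. -/
def RedN (s : Polarity) (p : Role) (ℓ : Label) (b : Base) :
    ℕ → SType Role Label Base Θ → SType Role Label Base Θ → Prop
  | 0 => fun _ _ => False
  | n + 1 => RedStep s p ℓ b (RedN s p ℓ b n)

/-- The least fixed point of `RedStep`: sending for `s = send` and receiving for `s = recv`. -/
def Red (s : Polarity) (p : Role) (ℓ : Label) (b : Base) (U U' : SType Role Label Base Θ) : Prop :=
  ∃ n, RedN s p ℓ b n U U'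

/-- The rules defining `Sends` and `Recvs`, read off the heads of unfoldings, with `P` in place of
the predicate on the branches. -/
inductive ReadyStep (s : Polarity) (p : Role) (P : SType Role Label Base Θ → Prop)
    (T : SType Role Label Base Θ) : Prop
  | intro {q : Role} {I : Finset Label} {hI : I.Nonempty} {c : I → Base}
      {V : I → SType Role Label Base Θ} (hT : T.out = .choice s q I hI c V)
      (h : q = p ∨ ∀ i, P (V i))

/-- Every path meets a choice of polarity `s` with `p` within `n` choices, all of polarity `s`. -/
def ReadyN (s : Polarity) (p : Role) : ℕ → SType Role Label Base Θ → Prop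
  | 0 => fun _ => False
  | n + 1 => ReadyStep s p (ReadyN s p n)

/-- The least fixed point of `ReadyStep`: `Sends p` for `s = send` and `Recvs p` for `s = recv`. -/
def Ready (s : Polarity) (p : Role) (T : SType Role Label Base Θ) : Prop :=
  ∃ n, ReadyN s p n T

theorem exists_forall_of_monotone {ι α : Type*} [Finite ι] [Preorder α] [Nonempty α]
    [IsDirectedOrder α] {P : ι → α → Prop}
    (hP : ∀ i, Monotone (P i)) (h : ∀ i, ∃ n, P i n) : ∃ n, ∀ i, P i n := by
  choose f hf using h
  obtain ⟨n, hn⟩ := Finite.exists_le f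
  exact ⟨n, fun i => hP i (hn i) (hf i)⟩

section RedStep

variable {R R' : SType Role Label Base Θ → SType Role Label Base Θ → Prop}
  {U U₁ U' : SType Role Label Base Θ} {I : Finset Label} {hI : I.Nonempty} {c : I → Base}
  {V : I → SType Role Label Base Θ}

theorem RedStep.mono (hR : R ≤ R') (h : RedStep s p ℓ b R U U') : RedStep s p ℓ b R' U U' := by
  cases h with
  | base hU hℓ hb => exact .base hU hℓ hb
  | same hU hpq J hJ hJI V' h => exact .same hU hpq J hJ hJI V' fun i => hR _ _ (h i)
  | opposite hU hs V' h => exact .opposite hU hs V' fun i => hR _ _ (h i)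

theorem RedStep.congr (h : RedStep s p ℓ b R U U') (e : U.out = U₁.out) :
    RedStep s p ℓ b R U₁ U' := by
  cases h with
  | base hU hℓ hb => exact .base (e ▸ hU) hℓ hb
  | same hU hpq J hJ hJI V' h => exact .same (e ▸ hU) hpq J hJ hJI V' h
  | opposite hU hs V' h => exact .opposite (e ▸ hU) hs V' h

theorem RedStep.exists_out_eq_choice (h : RedStep s p ℓ b R U U') :
    ∃ s' q I hI c V, U.out = .choice s' q I hI c V := by
  cases h with
  | base hU => exact ⟨_, _, _, _, _, _, hU⟩
  | same hU => exact ⟨_, _, _, _, _, _, hU⟩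
  | opposite hU => exact ⟨_, _, _, _, _, _, hU⟩

theorem RedStep.eq_branch (h : RedStep s p ℓ b R U U') (hU : U.out = .choice s p I hI c V) :
    ∃ hℓ : ℓ ∈ I, c ⟨ℓ, hℓ⟩ = b ∧ U' = V ⟨ℓ, hℓ⟩ := by
  cases h with
  | base hU' hℓ hb => rw [hU] at hU'; cases hU'; exact ⟨hℓ, hb, rfl⟩
  | same hU' hpq => rw [hU] at hU'; cases hU'; exact absurd rfl hpq
  | opposite hU' hs => rw [hU] at hU'; cases hU'; exact absurd rfl hs

theorem RedStep.eq_choice_subset (h : RedStep s p ℓ b R U U')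
    (hU : U.out = .choice s q I hI c V) (hpq : p ≠ q) :
    ∃ (J : Finset Label) (hJ : J.Nonempty) (hJI : J ⊆ I) (V' : J → SType Role Label Base Θ),
      U' = choice s q J hJ (fun i => c ⟨i, hJI i.2⟩) V' ∧
      ∀ i : J, R (V ⟨i, hJI i.2⟩) (V' i) := by
  cases h with
  | base hU' hℓ hb => rw [hU] at hU'; cases hU'; exact absurd rfl hpq
  | same hU' _ J hJ hJI V' h => rw [hU] at hU'; cases hU'; exact ⟨J, hJ, hJI, V', rfl, h⟩
  | opposite hU' hs => rw [hU] at hU'; cases hU'; exact absurd rfl hs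

theorem RedStep.eq_choice_opposite (h : RedStep s p ℓ b R U U')
    (hU : U.out = .choice s' q I hI c V) (hs : s' ≠ s) :
    ∃ V' : I → SType Role Label Base Θ,
      U' = choice s' q I hI c V' ∧ ∀ i, R (V i) (V' i) := by
  cases h with
  | base hU' => rw [hU] at hU'; cases hU'; exact absurd rfl hs
  | same hU' => rw [hU] at hU'; cases hU'; exact absurd rfl hs
  | opposite hU' _ V' h => rw [hU] at hU'; cases hU'; exact ⟨V', rfl, h⟩

theorem RedStep.exists_of_monotone
    {R : ℕ → SType Role Label Base Θ → SType Role Label Base Θ → Prop} (hR : Monotone R)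
    (h : RedStep s p ℓ b (fun U U' => ∃ n, R n U U') U U') : ∃ n, RedStep s p ℓ b (R n) U U' := by
  cases h with
  | base hU hℓ hb => exact ⟨0, .base hU hℓ hb⟩
  | @same _ _ _ _ V hU hpq J hJ hJI V' h =>
    obtain ⟨n, hn⟩ := exists_forall_of_monotone
      (P := fun (i : J) n => R n (V ⟨i, hJI i.2⟩) (V' i)) (fun _ _ _ hmn => hR hmn _ _) h
    exact ⟨n, .same hU hpq J hJ hJI V' hn⟩
  | @opposite _ _ _ _ _ V hU hs V' h =>
    obtain ⟨n, hn⟩ := exists_forall_of_monotone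
      (P := fun i n => R n (V i) (V' i)) (fun _ _ _ hmn => hR hmn _ _) h
    exact ⟨n, .opposite hU hs V' hn⟩

theorem RedN.monotone : Monotone (RedN s p ℓ b (Θ := Θ)) := by
  refine monotone_nat_of_le_succ fun n => ?_
  induction n with
  | zero => exact fun _ _ h => h.elim
  | succ n ih => exact fun _ _ h => RedStep.mono ih h

theorem red_iff : Red s p ℓ b U U' ↔ RedStep s p ℓ b (Red s p ℓ b) U U' := by
  constructor
  · rintro ⟨_ | n, h⟩
    · exact h.elim
    · exact RedStep.mono (fun _ _ h => ⟨n, h⟩) h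
  · intro h
    obtain ⟨n, hn⟩ := RedStep.exists_of_monotone RedN.monotone h
    exact ⟨n + 1, hn⟩

theorem Red.branch (hU : U.out = .choice s p I hI c V) (i : I) : Red s p i.1 (c i) U (V i) :=
  ⟨1, .base hU i.2 rfl⟩

theorem Red.out_ne_var (h : Red s p ℓ b U U') (X : Θ) : U.out ≠ .var X := by
  obtain ⟨_, _, _, _, _, _, hU⟩ := (red_iff.1 h).exists_out_eq_choice
  rw [hU]
  nofun

theorem Red.congr (h : Red s p ℓ b U U') (e : U.out = U₁.out) : Red s p ℓ b U₁ U' :=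
  red_iff.2 ((red_iff.1 h).congr e)

theorem RedN.subst (h : RedN s p ℓ b n U U') (σ : Θ → SType Role Label Base Θ₁) :
    RedN s p ℓ b n (U.subst σ) (U'.subst σ) := by
  induction n generalizing U U' with
  | zero => exact h.elim
  | succ n ih =>
    cases h with
    | base hU hℓ hb => exact .base (out_subst_of_choice hU σ) hℓ hb
    | same hU hpq J hJ hJI V' h =>
      rw [choice_subst]
      exact .same (out_subst_of_choice hU σ) hpq J hJ hJI _ fun i => ih (h i)
    | opposite hU hs V' h =>
      rw [choice_subst]
      exact .opposite (out_subst_of_choice hU σ) hs _ fun i => ih (h i)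

theorem Red.subst (h : Red s p ℓ b U U') (σ : Θ → SType Role Label Base Θ₁) :
    Red s p ℓ b (U.subst σ) (U'.subst σ) :=
  h.imp fun _ h => h.subst σ

theorem RedN.wf (h : RedN s p ℓ b n U U') (hU : U.WF) : U'.WF := by
  induction n generalizing U U' with
  | zero => exact h.elim
  | succ n ih =>
    cases h with
    | base hout hℓ hb => exact hU.of_out hout _
    | same hout hpq J hJ hJI V' h => exact wf_choice.2 fun i => ih (h i) (hU.of_out hout _)
    | opposite hout hs V' h => exact wf_choice.2 fun i => ih (h i) (hU.of_out hout _)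

theorem Red.wf (h : Red s p ℓ b U U') (hU : U.WF) : U'.WF :=
  h.elim fun _ h => h.wf hU

end RedStep

section ReadyStep

variable {P P' : SType Role Label Base Θ → Prop} {T T₁ : SType Role Label Base Θ}
  {I : Finset Label} {hI : I.Nonempty} {c : I → Base} {V : I → SType Role Label Base Θ}

theorem ReadyStep.mono (hP : P ≤ P') : ReadyStep s p P T → ReadyStep s p P' T
  | .intro hT h => .intro hT (h.imp_right fun h i => hP _ (h i))

theorem ReadyStep.congr (e : T.out = T₁.out) : ReadyStep s p P T → ReadyStep s p P T₁
  | .intro hT h => .intro (e ▸ hT) h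

theorem ReadyStep.eq_or_forall (h : ReadyStep s p P T) (hT : T.out = .choice s q I hI c V) :
    q = p ∨ ∀ i, P (V i) := by
  obtain ⟨hT', h⟩ := h
  rw [hT] at hT'
  cases hT'
  exact h

theorem ReadyN.monotone : Monotone (ReadyN s p (Θ := Θ) (Label := Label) (Base := Base)) := by
  refine monotone_nat_of_le_succ fun n => ?_
  induction n with
  | zero => exact fun _ h => h.elim
  | succ n ih => exact fun _ h => ReadyStep.mono ih h

theorem ready_iff : Ready s p T ↔ ReadyStep s p (Ready s p) T := by
  constructor
  · rintro ⟨_ | n, h⟩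
    · exact h.elim
    · exact ReadyStep.mono (fun _ h => ⟨n, h⟩) h
  · rintro @⟨q, I, hI, c, V, hT, rfl | h⟩
    · exact ⟨1, .intro hT (.inl rfl)⟩
    · obtain ⟨n, hn⟩ := exists_forall_of_monotone
        (P := fun i n => ReadyN s p n (V i)) (fun _ _ _ hmn => ReadyN.monotone hmn _) h
      exact ⟨n + 1, .intro hT (.inr hn)⟩

theorem Ready.of_out (hT : T.out = .choice s p I hI c V) : Ready s p T :=
  ready_iff.2 (.intro hT (.inl rfl))

theorem Ready.of_branches (hT : T.out = .choice s q I hI c V) (h : ∀ i, Ready s p (V i)) :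
    Ready s p T :=
  ready_iff.2 (.intro hT (.inr h))

theorem Ready.congr (h : Ready s p T) (e : T.out = T₁.out) : Ready s p T₁ :=
  ready_iff.2 ((ready_iff.1 h).congr e)

theorem ReadyN.subst (h : ReadyN s p n T) (σ : Θ → SType Role Label Base Θ₁) :
    ReadyN s p n (T.subst σ) := by
  induction n generalizing T with
  | zero => exact h.elim
  | succ n ih =>
    obtain ⟨hT, h⟩ := h
    exact .intro (out_subst_of_choice hT σ) (h.imp_right fun h i => ih (h i))

theorem Ready.subst (h : Ready s p T) (σ : Θ → SType Role Label Base Θ₁) : Ready s p (T.subst σ) :=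
  h.imp fun _ h => h.subst σ

end ReadyStep

/-! ### Commutation and exchange -/

section Commutation

variable {T T' T₁ U : SType Role Label Base Θ}

theorem RedN.commute (h : RedN s p ℓ b n T T') (h₁ : Red s.dual q ℓ' b' T T₁) :
    ∃ T₁', RedN s p ℓ b n T₁ T₁' ∧ Red s.dual q ℓ' b' T' T₁' := by
  induction n generalizing T T' T₁ with
  | zero => exact h.elim
  | succ n ih =>
    cases h with
    | base hT hℓ hb =>
      obtain ⟨V₁, rfl, hV₁⟩ := (red_iff.1 h₁).eq_choice_opposite hT s.dual_ne.symm
      exact ⟨_, .base (out_choice ..) hℓ hb, hV₁ _⟩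
    | same hT hpr J hJ hJI V' hV' =>
      obtain ⟨V₁, rfl, hV₁⟩ := (red_iff.1 h₁).eq_choice_opposite hT s.dual_ne.symm
      choose W hVW hWV using fun i => ih (hV' i) (hV₁ _)
      exact ⟨_, .same (out_choice ..) hpr J hJ hJI W hVW,
        red_iff.2 (.opposite (out_choice ..) s.dual_ne.symm W hWV)⟩
    | @opposite _ r _ _ _ _ hT hs V' hV' =>
      obtain rfl := Polarity.eq_dual_of_ne hs
      by_cases hqr : q = r
      · subst hqr
        obtain ⟨hℓ', rfl, rfl⟩ := (red_iff.1 h₁).eq_branch hT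
        exact ⟨_, RedN.monotone n.le_succ _ _ (hV' _), .branch (out_choice ..) ⟨ℓ', hℓ'⟩⟩
      · obtain ⟨J, hJ, hJI, V₁, rfl, hV₁⟩ := (red_iff.1 h₁).eq_choice_subset hT hqr
        choose W hVW hWV using fun i => ih (hV' _) (hV₁ i)
        exact ⟨_, .opposite (out_choice ..) hs W hVW,
          red_iff.2 (.same (out_choice ..) hqr J hJ hJI W hWV)⟩

theorem ReadyN.red (h : ReadyN s p n T) (hpq : q ≠ p) (hT : Red s q ℓ b T T') :
    ReadyN s p n T' := by
  induction n generalizing T T' with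
  | zero => exact h.elim
  | succ n ih =>
    obtain @⟨r, I, hI, c, V, hout, h⟩ := h
    by_cases hqr : q = r
    · subst hqr
      obtain ⟨hℓ, rfl, rfl⟩ := (red_iff.1 hT).eq_branch hout
      exact ReadyN.monotone n.le_succ _ (h.resolve_left hpq _)
    · obtain ⟨J, hJ, hJI, V', rfl, hV'⟩ := (red_iff.1 hT).eq_choice_subset hout hqr
      exact .intro (out_choice ..) (h.imp_right fun h i => ih (h _) (hV' i))

end Commutation

section Exchange

variable {U : SType Role Label Base Θ} {r : Role} {I : Finset Label} {hI : I.Nonempty}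
  {c : I → Base} {W : I → SType Role Label Base Θ} {ι : Type v} [Nonempty ι] {m : ι ↪ Label}
  {β : ι → Base} {V' : ι → SType Role Label Base Θ}

/-- Reductions of `U` by messages to `q`, with pairwise distinct labels and derivations of height
at most `n`, each followed by the same message to `p`, can be reordered so that the message to `p`
comes first and leads to a type shared by the whole family. -/
def ExchangesAt (s : Polarity) (p q : Role) (ℓ : Label) (b : Base) (n : ℕ)
    (U : SType Role Label Base Θ) : Prop :=
  ∀ ⦃ι : Type v⦄ [Nonempty ι] (m : ι ↪ Label) (β : ι → Base) (V' : ι → SType Role Label Base Θ),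
    (∀ i, ∃ V, RedN s q (m i) (β i) n U V ∧ Red s p ℓ b V (V' i)) →
    ∃ U', Red s p ℓ b U U' ∧ ∀ i, Red s q (m i) (β i) U' (V' i)

theorem exists_exchange_of_first (hU : U.out = .choice s q I hI c W) (hpq : p ≠ q)
    (h : ∀ i, ∃ V, Red s q (m i) (β i) U V ∧ Red s p ℓ b V (V' i)) :
    ∃ U', Red s p ℓ b U U' ∧ ∀ i, Red s q (m i) (β i) U' (V' i) := by
  classical
  have hbranch (i) : ∃ hm : m i ∈ I, c ⟨m i, hm⟩ = β i ∧ Red s p ℓ b (W ⟨m i, hm⟩) (V' i) := by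
    obtain ⟨V, hV, hV'⟩ := h i
    obtain ⟨hm, hc, rfl⟩ := (red_iff.1 hV).eq_branch hU
    exact ⟨hm, hc, hV'⟩
  choose hm hc hred using hbranch
  let J := I.filter fun k => ∃ i, m i = k
  have hJI : J ⊆ I := Finset.filter_subset _ _
  have hmJ (i) : m i ∈ J := Finset.mem_filter.2 ⟨hm i, i, rfl⟩
  have hJ : J.Nonempty := ⟨_, hmJ (Classical.arbitrary ι)⟩
  choose index hindex using fun k : J => (Finset.mem_filter.1 k.2).2
  have index_m (i) : index ⟨m i, hmJ i⟩ = i := m.injective (hindex _)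
  have hred' (k : J) : Red s p ℓ b (W ⟨k, hJI k.2⟩) (V' (index k)) := by
    simpa only [hindex] using hred (index k)
  refine ⟨_, red_iff.2 (.same hU hpq J hJ hJI _ hred'), fun i => ?_⟩
  simpa only [hc, index_m] using Red.branch
    (out_choice s q J hJ (fun k => c ⟨k, hJI k.2⟩) fun k => V' (index k)) ⟨m i, hmJ i⟩

theorem exists_exchange_of_second (hU : U.out = .choice s p I hI c W) (hpq : p ≠ q)
    (h : ∀ i, ∃ V, Red s q (m i) (β i) U V ∧ Red s p ℓ b V (V' i)) :
    ∃ U', Red s p ℓ b U U' ∧ ∀ i, Red s q (m i) (β i) U' (V' i) := by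
  have hbranch (i) : ∃ hℓ : ℓ ∈ I, c ⟨ℓ, hℓ⟩ = b ∧ Red s q (m i) (β i) (W ⟨ℓ, hℓ⟩) (V' i) := by
    obtain ⟨V, hV, hV'⟩ := h i
    obtain ⟨K, hK, hKI, X, rfl, hX⟩ := (red_iff.1 hV).eq_choice_subset hU hpq.symm
    obtain ⟨hℓ, hc, hV'X⟩ := (red_iff.1 hV').eq_branch (out_choice ..)
    exact ⟨hKI hℓ, hc, hV'X ▸ hX ⟨ℓ, hℓ⟩⟩
  obtain ⟨hℓ, rfl, -⟩ := hbranch (Classical.arbitrary ι)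
  exact ⟨_, .branch hU ⟨ℓ, hℓ⟩, fun i => (hbranch i).2.2⟩

theorem exchangesAt_of_same (hU : U.out = .choice s r I hI c W) (hpr : p ≠ r) (hqr : q ≠ r)
    (hW : ∀ k, ExchangesAt s p q ℓ b n (W k)) : ExchangesAt s p q ℓ b (n + 1) U := by
  classical
  intro ι _ m β V' h
  have hbranch (i) : ∃ (K : Finset Label) (hK : K.Nonempty) (hKI : K ⊆ I)
      (X : K → SType Role Label Base Θ), V' i = choice s r K hK (fun k => c ⟨k, hKI k.2⟩) X ∧
      ∀ k : K, ∃ Y, RedN s q (m i) (β i) n (W ⟨k, hKI k.2⟩) Y ∧ Red s p ℓ b Y (X k) := by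
    obtain ⟨V, hV, hV'⟩ := h i
    obtain ⟨K, hK, hKI, X, rfl, hX⟩ := hV.eq_choice_subset hU hqr
    obtain ⟨K', hK', hKK', X', hX', hXX'⟩ := (red_iff.1 hV').eq_choice_subset (out_choice ..) hpr
    exact ⟨K', hK', hKK'.trans hKI, X', hX', fun k => ⟨_, hX ⟨k, hKK' k.2⟩, hXX' k⟩⟩
  choose K hK hKI X hV' hX using hbranch
  let L := I.filter fun k => ∃ i, k ∈ K i
  have hLI : L ⊆ I := Finset.filter_subset _ _
  have hKL (i) : K i ⊆ L := fun k hk => Finset.mem_filter.2 ⟨hKI i hk, i, hk⟩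
  have hexchange (k : L) : ∃ Z, Red s p ℓ b (W ⟨k, hLI k.2⟩) Z ∧
      ∀ i : { i // k.1 ∈ K i }, Red s q (m i) (β i) Z (X i ⟨k, i.2⟩) := by
    have : Nonempty { i // k.1 ∈ K i } := nonempty_subtype.2 (Finset.mem_filter.1 k.2).2
    exact hW _ ((Function.Embedding.subtype _).trans m) _ _ fun i => hX i ⟨k, i.2⟩
  choose Z hWZ hZX using hexchange
  refine ⟨_, red_iff.2 (.same hU hpr L ((hK (Classical.arbitrary ι)).mono (hKL _)) hLI Z hWZ),
    fun i => ?_⟩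
  rw [hV']
  exact red_iff.2 (.same (out_choice ..) hqr (K i) (hK i) (hKL i) (X i)
    fun k => hZX ⟨k, hKL i k.2⟩ ⟨i, k.2⟩)

theorem exchangesAt_of_opposite (hU : U.out = .choice s' r I hI c W) (hs : s' ≠ s)
    (hW : ∀ k, ExchangesAt s p q ℓ b n (W k)) : ExchangesAt s p q ℓ b (n + 1) U := by
  intro ι _ m β V' h
  have hbranch (i) : ∃ X : I → SType Role Label Base Θ, V' i = choice s' r I hI c X ∧
      ∀ k, ∃ Y, RedN s q (m i) (β i) n (W k) Y ∧ Red s p ℓ b Y (X k) := by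
    obtain ⟨V, hV, hV'⟩ := h i
    obtain ⟨X, rfl, hX⟩ := hV.eq_choice_opposite hU hs
    obtain ⟨X', hX', hXX'⟩ := (red_iff.1 hV').eq_choice_opposite (out_choice ..) hs
    exact ⟨X', hX', fun k => ⟨_, hX k, hXX' k⟩⟩
  choose X hV' hX using hbranch
  choose Z hWZ hZX using fun k => hW k m β (X · k) (hX · k)
  refine ⟨_, red_iff.2 (.opposite hU hs Z hWZ), fun i => ?_⟩
  rw [hV']
  exact red_iff.2 (.opposite (out_choice ..) hs _ (hZX · i))

theorem exchangesAt (hpq : p ≠ q) (n : ℕ) (U : SType Role Label Base Θ) :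
    ExchangesAt s p q ℓ b n U := by
  induction n generalizing U with
  | zero => exact fun ι _ m β V' h => (h (Classical.arbitrary ι)).elim fun _ hV => hV.1.elim
  | succ n ih =>
    intro ι _ m β V' h
    have hred (i) : ∃ V, Red s q (m i) (β i) U V ∧ Red s p ℓ b V (V' i) :=
      (h i).imp fun _ hV => ⟨⟨_, hV.1⟩, hV.2⟩
    obtain ⟨V, hV, -⟩ := h (Classical.arbitrary ι)
    obtain ⟨s', r, I, hI, c, W, hU⟩ := hV.exists_out_eq_choice
    by_cases hs : s' = s
    · subst hs
      rcases eq_or_ne q r with rfl | hqr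
      · exact exists_exchange_of_first hU hpq hred
      rcases eq_or_ne p r with rfl | hpr
      · exact exists_exchange_of_second hU hpq hred
      exact exchangesAt_of_same hU hpr hqr (fun k => ih _) m β V' h
    · exact exchangesAt_of_opposite hU hs (fun k => ih _) m β V' h

theorem Red.exchange (hpq : p ≠ q) {J : Finset Label} (hJ : J.Nonempty) {β : J → Base}
    {V V' : J → SType Role Label Base Θ} (hUV : ∀ i : J, Red s q i.1 (β i) U (V i))
    (hVV' : ∀ i, Red s p ℓ b (V i) (V' i)) :
    ∃ U', Red s p ℓ b U U' ∧ ∀ i : J, Red s q i.1 (β i) U' (V' i) := by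
  have : Nonempty J := hJ.to_subtype
  obtain ⟨n, hn⟩ := exists_forall_of_monotone
    (P := fun (i : J) n => RedN s q i.1 (β i) n U (V i))
    (fun _ _ _ hmn => RedN.monotone hmn _ _) hUV
  exact exchangesAt hpq n U (.subtype _) β V' fun i => ⟨_, hn i, hVV' i⟩

end Exchange

/-! ### Subtyping in both orientations -/

/-- The closure conditions of asynchronous subtyping, for a relation together with its converse:
`R .send T U` stands for `T <: U` and `R .recv U T` for the same relation read from right to left.
Each condition on a pair of types thereby covers its mirror image. -/
structure IsOrientedSimulation
    (R : Polarity → SType Role Label Base Θ → SType Role Label Base Θ → Prop) : Prop where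
  symm {s T U} : R s T U → R s.dual U T
  red {s T U p I hI c V} : R s T U → T.out = .choice s p I hI c V →
    ∀ i : I, ∃ U', Red s p i.1 (c i) U U' ∧ R s (V i) U'
  ready {s T U p I hI c V} : R s T U → T.out = .choice s.dual p I hI c V → Ready s.dual p U
  var {s T U X} : R s T U → T.out = .var X → U.out = .var X

/-- The largest oriented simulation: `<:` for `s = send` and its converse for `s = recv`. It also
relates types that are not well-formed. -/
def OrientedSub (s : Polarity) (T U : SType Role Label Base Θ) : Prop :=
  ∃ R, IsOrientedSimulation R ∧ R s T U

theorem isOrientedSimulation_orientedSub :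
    IsOrientedSimulation (OrientedSub (Role := Role) (Label := Label) (Base := Base) (Θ := Θ)) where
  symm := fun ⟨R, hR, h⟩ => ⟨R, hR, hR.symm h⟩
  red := fun ⟨R, hR, h⟩ hT i =>
    let ⟨U', hU, h'⟩ := hR.red h hT i
    ⟨U', hU, R, hR, h'⟩
  ready := fun ⟨_, hR, h⟩ => hR.ready h
  var := fun ⟨_, hR, h⟩ => hR.var h

section OrientedSub

variable {S T T₁ T' U U₁ : SType Role Label Base Θ} {r : Role} {I J : Finset Label}
  {hI : I.Nonempty} {hJ : J.Nonempty} {c : I → Base} {d : J → Base}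
  {V : I → SType Role Label Base Θ} {W : J → SType Role Label Base Θ}

theorem orientedSub_dual : OrientedSub s.dual T U ↔ OrientedSub s U T :=
  ⟨fun h => s.dual_dual ▸ isOrientedSimulation_orientedSub.symm h,
    isOrientedSimulation_orientedSub.symm⟩

theorem OrientedSub.exists_red (h : OrientedSub s T U) (hT : T.out = .choice s p I hI c V)
    (i : I) : ∃ U', Red s p i.1 (c i) U U' ∧ OrientedSub s (V i) U' :=
  isOrientedSimulation_orientedSub.red h hT i

theorem OrientedSub.exists_red_dual (h : OrientedSub s T U)
    (hU : U.out = .choice s.dual p I hI c V) (i : I) :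
    ∃ T', Red s.dual p i.1 (c i) T T' ∧ OrientedSub s T' (V i) :=
  ((orientedSub_dual.2 h).exists_red hU i).imp fun _ => And.imp_right orientedSub_dual.1

theorem OrientedSub.ready (h : OrientedSub s T U) (hT : T.out = .choice s.dual p I hI c V) :
    Ready s.dual p U :=
  isOrientedSimulation_orientedSub.ready h hT

theorem OrientedSub.ready_left (h : OrientedSub s T U) (hU : U.out = .choice s p I hI c V) :
    Ready s p T := by
  rw [← s.dual_dual] at hU ⊢
  exact (orientedSub_dual.2 h).ready hU

theorem OrientedSub.out_eq_var (h : OrientedSub s T U) {X : Θ} (hT : T.out = .var X) :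
    U.out = .var X :=
  isOrientedSimulation_orientedSub.var h hT

theorem OrientedSub.refl (s : Polarity) (T : SType Role Label Base Θ) : OrientedSub s T T :=
  ⟨fun _ => Eq,
    { symm := Eq.symm
      red := by rintro s T _ p I hI c V rfl hT i; exact ⟨_, .branch hT i, rfl⟩
      ready := by rintro s T _ p I hI c V rfl hT; exact .of_out hT
      var := by rintro _ T _ X rfl hT; exact hT }, rfl⟩

theorem OrientedSub.congr (h : OrientedSub s T U) (hT : T.out = T₁.out) (hU : U.out = U₁.out) :
    OrientedSub s T₁ U₁ := by
  refine ⟨fun s T₁ U₁ => ∃ T U, OrientedSub s T U ∧ T.out = T₁.out ∧ U.out = U₁.out,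
    { symm := ?_, red := ?_, ready := ?_, var := ?_ }, T, U, h, hT, hU⟩
  · rintro s T₁ U₁ ⟨T, U, h, hT, hU⟩
    exact ⟨U, T, orientedSub_dual.2 h, hU, hT⟩
  · rintro s T₁ U₁ p I hI c V ⟨T, U, h, hT, hU⟩ hT₁ i
    obtain ⟨U', hUU', h'⟩ := h.exists_red (hT.trans hT₁) i
    exact ⟨U', hUU'.congr hU, V i, U', h', rfl, rfl⟩
  · rintro s T₁ U₁ p I hI c V ⟨T, U, h, hT, hU⟩ hT₁
    exact (h.ready (hT.trans hT₁)).congr hU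
  · rintro s T₁ U₁ X ⟨T, U, h, hT, hU⟩ hT₁
    exact hU.symm.trans (h.out_eq_var (hT.trans hT₁))

/-- `T` unfolds to a choice of polarity `s`, and `U` has a reduction to a supertype of every
branch. This alone is enough for `OrientedSub s T U`. -/
inductive Matched (s : Polarity) (T U : SType Role Label Base Θ) : Prop
  | intro {q : Role} {I : Finset Label} {hI : I.Nonempty} {c : I → Base}
      {V : I → SType Role Label Base Θ} (hT : T.out = .choice s q I hI c V)
      (h : ∀ i : I, ∃ U', Red s q i.1 (c i) U U' ∧ OrientedSub s (V i) U')

theorem Matched.exists_red (h : Matched s T U) (hT : T.out = .choice s p I hI c V) (i : I) :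
    ∃ U', Red s p i.1 (c i) U U' ∧ OrientedSub s (V i) U' := by
  obtain ⟨hT', h⟩ := h
  rw [hT] at hT'
  cases hT'
  exact h i

theorem Matched.exists_red_dual (h : Matched s T U) (hU : U.out = .choice s.dual r J hJ d W)
    (k : J) : ∃ T', Red s.dual r k.1 (d k) T T' ∧ Matched s T' (W k) := by
  obtain @⟨q, I, hI, c, V, hT, h⟩ := h
  have hbranch (i) : ∃ V' W', Red s.dual r k.1 (d k) (V i) V' ∧ Red s q i.1 (c i) (W k) W' ∧
      OrientedSub s V' W' := by
    obtain ⟨U', hUU', hVU'⟩ := h i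
    obtain ⟨W', rfl, hW'⟩ := (red_iff.1 hUU').eq_choice_opposite hU s.dual_ne
    obtain ⟨V', hV', hVW'⟩ := hVU'.exists_red_dual (out_choice ..) k
    exact ⟨V', W' k, hV', hW' k, hVW'⟩
  choose V' W' hV' hW' hVW' using hbranch
  exact ⟨choice s q I hI c V', red_iff.2 (.opposite hT s.dual_ne.symm V' hV'),
    .intro (out_choice ..) fun i => ⟨W' i, hW' i, hVW' i⟩⟩

theorem Matched.ready_left (h : Matched s T U) (hU : U.out = .choice s r J hJ d W) :
    Ready s r T := by
  obtain @⟨q, I, hI, c, V, hT, h⟩ := h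
  rcases eq_or_ne q r with rfl | hqr
  · exact .of_out hT
  refine .of_branches hT fun i => ?_
  obtain ⟨U', hUU', hVU'⟩ := h i
  obtain ⟨K, hK, hKJ, W', rfl, -⟩ := (red_iff.1 hUU').eq_choice_subset hU hqr
  exact hVU'.ready_left (out_choice ..)

theorem Matched.out_ne_var_left (h : Matched s T U) (X : Θ) : T.out ≠ .var X := by
  obtain ⟨hT, -⟩ := h
  rw [hT]
  nofun

theorem Matched.out_ne_var_right (h : Matched s T U) (X : Θ) : U.out ≠ .var X := by
  obtain @⟨q, I, ⟨i, hi⟩, c, V, -, h⟩ := h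
  obtain ⟨U', hUU', -⟩ := h ⟨i, hi⟩
  exact hUU'.out_ne_var X

theorem OrientedSub.of_matched (h : Matched s T U) : OrientedSub s T U := by
  refine ⟨fun s T U => OrientedSub s T U ∨ Matched s T U ∨ Matched s.dual U T,
    { symm := ?_, red := ?_, ready := ?_, var := ?_ }, .inr (.inl h)⟩
  · rintro s T U (h | h | h)
    · exact .inl (orientedSub_dual.2 h)
    · exact .inr (.inr (s.dual_dual.symm ▸ h))
    · exact .inr (.inl h)
  · rintro s T U p I hI c V (h | h | h) hT i
    · exact (h.exists_red hT i).imp fun _ => And.imp_right .inl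
    · exact (h.exists_red hT i).imp fun _ => And.imp_right .inl
    · rw [← s.dual_dual] at hT
      have := h.exists_red_dual hT i
      rw [s.dual_dual] at this
      exact this.imp fun _ => And.imp_right (.inr ∘ .inr)
  · rintro s T U p I hI c V (h | ⟨hT', -⟩ | h) hT
    · exact h.ready hT
    · rw [hT] at hT'
      exact absurd (Head.choice.inj hT').1 s.dual_ne
    · exact h.ready_left hT
  · rintro s T U X (h | h | h) hT
    · exact h.out_eq_var hT
    · exact absurd hT (h.out_ne_var_left X)
    · exact absurd hT (h.out_ne_var_right X)

theorem OrientedSub.of_matched_dual (h : Matched s.dual U T) : OrientedSub s T U :=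
  orientedSub_dual.1 (.of_matched h)

theorem OrientedSub.choice {hJI : J ⊆ I} {c : I → Base} {T : J → SType Role Label Base Θ}
    {U : I → SType Role Label Base Θ} (s : Polarity) (p : Role)
    (h : ∀ i : J, OrientedSub s (T i) (U ⟨i, hJI i.2⟩)) :
    OrientedSub s (choice s p J hJ (fun i => c ⟨i, hJI i.2⟩) T) (choice s p I hI c U) :=
  .of_matched <| .intro (out_choice ..) fun i =>
    ⟨_, .branch (out_choice s p I hI c U) ⟨i, hJI i.2⟩, h i⟩

/-! ### Transitivity -/

/-- The induction is on the height of `U`, seen as a tree of choices of polarity `s.dual` with a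
choice with `q` on every path. -/
theorem OrientedSub.dual_induction {P : SType Role Label Base Θ → SType Role Label Base Θ → Prop}
    (self : ∀ ⦃T U I hI c V⦄ ⦃J : Finset Label⦄ ⦃hJ d W⦄, T.out = .choice s.dual q I hI c V →
      U.out = .choice s.dual q J hJ d W →
      (∀ k : J, ∃ hk : k.1 ∈ I, c ⟨k, hk⟩ = d k ∧ OrientedSub s (V ⟨k, hk⟩) (W k)) → P T U)
    (other : ∀ ⦃T U r⦄ ⦃J : Finset Label⦄ ⦃hJ d W⦄, U.out = .choice s.dual r J hJ d W →
      (∀ k : J, ∃ T₁, Red s.dual r k.1 (d k) T T₁ ∧ OrientedSub s T₁ (W k) ∧ P T₁ (W k)) → P T U)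
    (h : OrientedSub s T U) (hT : T.out = .choice s.dual q I hI c V) : P T U := by
  obtain ⟨n, hn⟩ := h.ready hT
  induction n generalizing T U I with
  | zero => exact hn.elim
  | succ n ih =>
    obtain @⟨r, J, hJ, d, W, hU, hn⟩ := hn
    rcases eq_or_ne r q with rfl | hrq
    · refine self hT hU fun k => ?_
      obtain ⟨T₁, hTT₁, h₁⟩ := h.exists_red_dual hU k
      obtain ⟨hk, hck, rfl⟩ := (red_iff.1 hTT₁).eq_branch hT
      exact ⟨hk, hck, h₁⟩
    · refine other hU fun k => ?_
      obtain ⟨T₁, hTT₁, h₁⟩ := h.exists_red_dual hU k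
      obtain ⟨K, hK, hKI, V', rfl, -⟩ := (red_iff.1 hTT₁).eq_choice_subset hT hrq
      exact ⟨_, hTT₁, h₁, ih h₁ (out_choice ..) (hn.resolve_left hrq k)⟩

theorem OrientedSub.ready_of_ready (h : OrientedSub s T U) (hT : Ready s.dual p T) :
    Ready s.dual p U := by
  obtain ⟨n, hn⟩ := hT
  induction n generalizing T U with
  | zero => exact hn.elim
  | succ n ih =>
    obtain ⟨hT, -⟩ := id hn
    revert hn
    refine h.dual_induction (P := fun T U => ReadyN s.dual p (n + 1) T → Ready s.dual p U) ?_ ?_ hT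
    · intro T U I hI c V J hJ d W hT hU h hn
      rcases hn.eq_or_forall hT with rfl | hV
      · exact .of_out hU
      refine .of_branches hU fun k => ?_
      obtain ⟨hk, -, hVW⟩ := h k
      exact ih hVW (hV ⟨k, hk⟩)
    · intro T U r J hJ d W hU h hn
      rcases eq_or_ne r p with rfl | hrp
      · exact .of_out hU
      refine .of_branches hU fun k => ?_
      obtain ⟨T₁, hTT₁, -, hready⟩ := h k
      exact hready (hn.red hrp hTT₁)

theorem OrientedSub.exists_red_of_same (h : OrientedSub s T U)
    (hT : T.out = .choice s q I hI c V) (hpq : p ≠ q) (hJI : J ⊆ I) (hJ : J.Nonempty)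
    {V' : J → SType Role Label Base Θ}
    (hV : ∀ (i : J) U, OrientedSub s (V ⟨i, hJI i.2⟩) U →
      ∃ U', Red s p ℓ b U U' ∧ OrientedSub s (V' i) U') :
    ∃ U', Red s p ℓ b U U' ∧
      OrientedSub s (SType.choice s q J hJ (fun i => c ⟨i, hJI i.2⟩) V') U' := by
  choose U₁ hUU₁ hVU₁ using h.exists_red hT
  choose W hUW hVW using fun i : J => hV i _ (hVU₁ _)
  obtain ⟨U', hUU', hU'W⟩ := Red.exchange hpq hJ (fun i => hUU₁ ⟨i, hJI i.2⟩) hUW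
  exact ⟨U', hUU', .of_matched (.intro (out_choice ..) fun i => ⟨W i, hU'W i, hVW i⟩)⟩

theorem OrientedSub.exists_red_of_opposite (h : OrientedSub s T U)
    (hT : T.out = .choice s.dual q I hI c V) (hTT' : RedN s p ℓ b (n + 1) T T')
    (ih : ∀ ⦃V V' W : SType Role Label Base Θ⦄, OrientedSub s V W → RedN s p ℓ b n V V' →
      ∃ W', Red s p ℓ b W W' ∧ OrientedSub s V' W') :
    ∃ U', Red s p ℓ b U U' ∧ OrientedSub s T' U' := by
  revert T'
  refine h.dual_induction (P := fun T U => ∀ {T'}, RedN s p ℓ b (n + 1) T T' →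
    ∃ U', Red s p ℓ b U U' ∧ OrientedSub s T' U') ?_ ?_ hT
  · intro T U I hI c V J hJ d W hT hU h T' hTT'
    obtain ⟨V', rfl, hVV'⟩ := hTT'.eq_choice_opposite hT s.dual_ne
    choose hk hcd hVW using h
    choose W' hWW' hVW' using fun k => ih (hVW k) (hVV' _)
    refine ⟨_, red_iff.2 (.opposite hU s.dual_ne W' hWW'),
      .of_matched_dual (.intro (out_choice ..) fun k => ⟨_, ?_, orientedSub_dual.2 (hVW' k)⟩)⟩
    rw [← hcd]
    exact .branch (out_choice s.dual q I hI c V') ⟨k, hk k⟩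
  · intro T U r J hJ d W hU h T' hTT'
    choose T₁ hTT₁ _ hP using h
    choose T₁' hT₁T₁' hT'T₁' using fun k => hTT'.commute (hTT₁ k)
    choose W' hWW' hTW' using fun k => hP k (hT₁T₁' k)
    exact ⟨_, red_iff.2 (.opposite hU s.dual_ne W' hWW'), .of_matched_dual
      (.intro (out_choice ..) fun k => ⟨_, hT'T₁' k, orientedSub_dual.2 (hTW' k)⟩)⟩

theorem OrientedSub.exists_red_of_red (h : OrientedSub s T U) (hTT' : Red s p ℓ b T T') :
    ∃ U', Red s p ℓ b U U' ∧ OrientedSub s T' U' := by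
  obtain ⟨n, hn⟩ := hTT'
  induction n generalizing T U T' with
  | zero => exact hn.elim
  | succ n ih =>
    cases id hn with
    | base hT hℓ hb => exact hb ▸ h.exists_red hT ⟨ℓ, hℓ⟩
    | same hT hpq J hJ hJI V' hV =>
      exact h.exists_red_of_same hT hpq hJI hJ fun i U hVU => ih hVU (hV i)
    | opposite hT hs =>
      obtain rfl := Polarity.eq_dual_of_ne hs
      exact h.exists_red_of_opposite hT hn fun _ _ _ => ih

theorem OrientedSub.trans (hST : OrientedSub s S T) (hTU : OrientedSub s T U) :
    OrientedSub s S U := by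
  refine ⟨fun s S U => ∃ T, OrientedSub s S T ∧ OrientedSub s T U,
    { symm := ?_, red := ?_, ready := ?_, var := ?_ }, T, hST, hTU⟩
  · rintro s S U ⟨T, hST, hTU⟩
    exact ⟨T, orientedSub_dual.2 hTU, orientedSub_dual.2 hST⟩
  · rintro s S U p I hI c V ⟨T, hST, hTU⟩ hS i
    obtain ⟨T', hTT', hST'⟩ := hST.exists_red hS i
    obtain ⟨U', hUU', hTU'⟩ := hTU.exists_red_of_red hTT'
    exact ⟨U', hUU', T', hST', hTU'⟩
  · rintro s S U p I hI c V ⟨T, hST, hTU⟩ hS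
    exact hTU.ready_of_ready (hST.ready hS)
  · rintro s S U X ⟨T, hST, hTU⟩ hS
    exact hTU.out_eq_var (hST.out_eq_var hS)

end OrientedSub

/-! ### Substitution and recursion -/

section Substitution

variable {ρ : Polarity → Θ → SType Role Label Base Θ₁} {S S₁ T T₁ : SType Role Label Base Θ₁}

/-- The simulation behind substitution and recursion. Besides subtyping, it contains the results of
substituting `ρ s` and `ρ s.dual` in a pair of subtypes whose heads are not variables. These are
taken up to the head of the unfolding, so that `μX.S` counts as `S[X ↦ μX.S]`. -/
inductive SubstRel (ρ : Polarity → Θ → SType Role Label Base Θ₁) (s : Polarity)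
    (S T : SType Role Label Base Θ₁) : Prop
  | sub (h : OrientedSub s S T)
  | subst {S' T' : SType Role Label Base Θ} (h : OrientedSub s S' T')
      (hS' : ∀ X, S'.out ≠ .var X) (hS : (S'.subst (ρ s)).out = S.out)
      (hT : (T'.subst (ρ s.dual)).out = T.out)

theorem SubstRel.congr (h : SubstRel ρ s S T) (hS : S.out = S₁.out) (hT : T.out = T₁.out) :
    SubstRel ρ s S₁ T₁ := by
  cases h with
  | sub h => exact .sub (h.congr hS hT)
  | subst h hS' hS'S hT'T => exact .subst h hS' (hS'S.trans hS) (hT'T.trans hT)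

theorem SubstRel.symm (h : SubstRel ρ s S T) : SubstRel ρ s.dual T S := by
  cases h with
  | sub h => exact .sub (orientedSub_dual.2 h)
  | subst h hS' hS hT =>
    refine .subst (orientedSub_dual.2 h) (fun X hX => hS' X ?_) hT (s.dual_dual.symm ▸ hS)
    exact (orientedSub_dual.2 h).out_eq_var hX

theorem SubstRel.of_orientedSub (hρ : ∀ s X, SubstRel ρ s (ρ s X) (ρ s.dual X))
    {S' T' : SType Role Label Base Θ} (h : OrientedSub s S' T') :
    SubstRel ρ s (S'.subst (ρ s)) (T'.subst (ρ s.dual)) := by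
  by_cases hS' : ∃ X, S'.out = .var X
  · obtain ⟨X, hX⟩ := hS'
    exact (hρ s X).congr (out_subst_of_var hX _).symm (out_subst_of_var (h.out_eq_var hX) _).symm
  · exact .subst h (not_exists.1 hS') rfl rfl

theorem isOrientedSimulation_substRel (hρ : ∀ s X, SubstRel ρ s (ρ s X) (ρ s.dual X)) :
    IsOrientedSimulation (SubstRel ρ) where
  symm := SubstRel.symm
  red := by
    rintro s S T p I hI c V (h | @⟨S', T', h, hS', hS, hT⟩) hV i
    · exact (h.exists_red hV i).imp fun _ => And.imp_right .sub
    obtain ⟨V', hV', rfl⟩ := exists_out_eq_of_out_subst_eq_choice hS' (hS.trans hV)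
    obtain ⟨T'', hT'', h'⟩ := h.exists_red hV' i
    exact ⟨_, (hT''.subst _).congr hT, .of_orientedSub hρ h'⟩
  ready := by
    rintro s S T p I hI c V (h | @⟨S', T', h, hS', hS, hT⟩) hV
    · exact h.ready hV
    obtain ⟨V', hV', rfl⟩ := exists_out_eq_of_out_subst_eq_choice hS' (hS.trans hV)
    exact ((h.ready hV').subst _).congr hT
  var := by
    rintro s S T X (h | ⟨-, hS', hS, -⟩) hX
    · exact h.out_eq_var hX
    · exact absurd (hS.trans hX) (out_subst_ne_var hS' _ X)

theorem OrientedSub.subst {S T : SType Role Label Base Θ} {σ τ : Θ → SType Role Label Base Θ₁}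
    (h : OrientedSub .send S T) (hστ : ∀ X, OrientedSub .send (σ X) (τ X)) :
    OrientedSub .send (S.subst σ) (T.subst τ) := by
  let ρ : Polarity → Θ → SType Role Label Base Θ₁
    | .send => σ
    | .recv => τ
  have hρ : ∀ s X, SubstRel ρ s (ρ s X) (ρ s.dual X)
    | .send, X => .sub (hστ X)
    | .recv, X => (SubstRel.sub (hστ X)).symm
  exact ⟨_, isOrientedSimulation_substRel hρ, .of_orientedSub hρ h⟩

theorem OrientedSub.mu {S T : SType Role Label Base (Option Θ)} (h : OrientedSub .send S T) :
    OrientedSub .send (mu S) (mu T) := by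
  by_cases hS : ∃ o, S.out = .var o
  · obtain ⟨o, ho⟩ := hS
    refine (OrientedSub.refl .send (SType.mu S)).congr rfl ?_
    rw [out_mu, out_mu, ho, h.out_eq_var ho, Head.bind, Head.bind]
  let ρ : Polarity → Option Θ → SType Role Label Base Θ
    | .send => fun o => o.elim (SType.mu S) SType.var
    | .recv => fun o => o.elim (SType.mu T) SType.var
  have hmu : SubstRel ρ .send (SType.mu S) (SType.mu T) :=
    .subst h (not_exists.1 hS) (out_inst_mu S) (out_inst_mu T)
  have hρ : ∀ s o, SubstRel ρ s (ρ s o) (ρ s.dual o)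
    | .send, none => hmu
    | .recv, none => hmu.symm
    | .send, some X | .recv, some X => .sub (.refl _ (SType.var X))
  exact ⟨_, isOrientedSimulation_substRel hρ, hmu⟩

end Substitution

/-! ### The syntactic rules -/

section Syntactic

variable {I J : Finset Label} {hI : I.Nonempty} {hJ : J.Nonempty} {c : I → Base}
  {U U' : SType Role Label Base Θ} {V : I → SType Role Label Base Θ}

/-- `RedSend` or `RedRecv`, according to the polarity. -/
def SyntacticRed (s : Polarity) (p : Role) (ℓ : Label) (b : Base)
    (U U' : SType Role Label Base Θ) : Prop :=
  match s with
  | .send => RedSend p ℓ b U U'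
  | .recv => RedRecv p ℓ b U U'

theorem SyntacticRed.base (hℓ : ℓ ∈ I) :
    SyntacticRed s p ℓ (c ⟨ℓ, hℓ⟩) (choice s p I hI c V) (V ⟨ℓ, hℓ⟩) := by
  cases s <;> constructor <;> rfl

theorem SyntacticRed.same (hpq : p ≠ q) (hJI : J ⊆ I) {V' : J → SType Role Label Base Θ}
    (h : ∀ i : J, SyntacticRed s p ℓ b (V ⟨i, hJI i.2⟩) (V' i)) :
    SyntacticRed s p ℓ b (choice s q I hI c V) (choice s q J hJ (fun i => c ⟨i, hJI i.2⟩) V') := by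
  cases s <;> constructor <;> assumption

theorem SyntacticRed.opposite (hs : s' ≠ s) {V' : I → SType Role Label Base Θ}
    (h : ∀ i, SyntacticRed s p ℓ b (V i) (V' i)) :
    SyntacticRed s p ℓ b (choice s' q I hI c V) (choice s' q I hI c V') := by
  obtain rfl := Polarity.eq_dual_of_ne hs
  cases s <;> constructor <;> assumption

theorem SyntacticRed.mu {U : SType Role Label Base (Option Θ)}
    (h : SyntacticRed s p ℓ b (U.inst (mu U)) U') : SyntacticRed s p ℓ b (mu U) U' := by
  cases s <;> constructor <;> assumption

theorem RedN.syntacticRed (h : RedN s p ℓ b n U U') : SyntacticRed s p ℓ b U U' := by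
  induction n generalizing U U' with
  | zero => exact h.elim
  | succ n ih =>
    refine of_unfold (P := (SyntacticRed s p ℓ b · U')) (fun _ => SyntacticRed.mu) ?_
    cases h with
    | base hU hℓ hb =>
      rw [head_eq_choice.1 hU, ← hb]
      exact .base hℓ
    | same hU hpq J hJ hJI V' h =>
      rw [head_eq_choice.1 hU]
      exact .same hpq hJI fun i => ih (h i)
    | opposite hU hs V' h =>
      rw [head_eq_choice.1 hU]
      exact .opposite hs fun i => ih (h i)

theorem SyntacticRed.red (h : SyntacticRed s p ℓ b U U') : Red s p ℓ b U U' := by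
  cases s with
  | send =>
    induction (h : RedSend p ℓ b U U') with
    | base I hI c U hℓ hb => exact red_iff.2 (.base rfl hℓ hb)
    | send q hpq I J hI hJ hJI c U U' _ ih => exact red_iff.2 (.same rfl hpq J hJ hJI U' ih)
    | recv q I hI c U U' _ ih =>
      exact red_iff.2 (.opposite (out_choice .recv q I hI c U) (Polarity.dual_ne .send) U' ih)
    | mu U U' _ ih => exact ih.congr (out_inst_mu U)
  | recv =>
    induction (h : RedRecv p ℓ b U U') with
    | base I hI c U hℓ hb => exact red_iff.2 (.base rfl hℓ hb)
    | recv q hpq I J hI hJ hJI c U U' _ ih => exact red_iff.2 (.same rfl hpq J hJ hJI U' ih)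
    | send q I hI c U U' _ ih =>
      exact red_iff.2 (.opposite (out_choice .send q I hI c U) (Polarity.dual_ne .recv) U' ih)
    | mu U U' _ ih => exact ih.congr (out_inst_mu U)

theorem red_iff_syntacticRed : Red s p ℓ b U U' ↔ SyntacticRed s p ℓ b U U' :=
  ⟨fun ⟨_, h⟩ => h.syntacticRed, SyntacticRed.red⟩

/-- `Sends` or `Recvs`, according to the polarity. -/
def SyntacticReady (s : Polarity) (p : Role) (T : SType Role Label Base Θ) : Prop :=
  match s with
  | .send => Sends p T
  | .recv => Recvs p T

theorem syntacticReady_send : SyntacticReady s p (send q I hI c V) ↔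
    s = .send ∧ (q = p ∨ ∀ i, SyntacticReady s p (V i)) := by
  cases s with
  | recv => exact ⟨nofun, nofun⟩
  | send =>
    refine ⟨fun h => ⟨rfl, ?_⟩, ?_⟩
    · cases h with
      | base => exact .inl rfl
      | send _ _ _ _ _ h => exact .inr h
    · rintro ⟨-, rfl | h⟩
      · exact Sends.base ..
      · exact Sends.send _ _ _ _ _ h

theorem syntacticReady_recv : SyntacticReady s p (recv q I hI c V) ↔
    s = .recv ∧ (q = p ∨ ∀ i, SyntacticReady s p (V i)) := by
  cases s with
  | send => exact ⟨nofun, nofun⟩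
  | recv =>
    refine ⟨fun h => ⟨rfl, ?_⟩, ?_⟩
    · cases h with
      | base => exact .inl rfl
      | recv _ _ _ _ _ h => exact .inr h
    · rintro ⟨-, rfl | h⟩
      · exact Recvs.base ..
      · exact Recvs.recv _ _ _ _ _ h

theorem syntacticReady_mu {T : SType Role Label Base (Option Θ)} :
    SyntacticReady s p (mu T) ↔ SyntacticReady s p T := by
  cases s with
  | send => exact ⟨fun | .mu _ h => h, .mu T⟩
  | recv => exact ⟨fun | .mu _ h => h, .mu T⟩

theorem not_syntacticReady_var (X : Θ) :
    ¬ SyntacticReady s p (var X : SType Role Label Base Θ) := by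
  cases s <;> exact nofun

theorem SyntacticReady.of_rename {T : SType Role Label Base Θ} {Θ₁ : Type u} {f : Θ → Θ₁}
    (h : SyntacticReady s p (T.rename f)) : SyntacticReady s p T := by
  induction T generalizing Θ₁ with
  | fin => cases s <;> cases h
  | var X => exact absurd h (not_syntacticReady_var _)
  | send q I hI b T ih | recv q I hI b T ih =>
    simp only [rename, syntacticReady_send, syntacticReady_recv] at h ⊢
    exact h.imp_right (Or.imp_right fun h i => ih i (h i))
  | mu T ih => exact syntacticReady_mu.2 (ih (syntacticReady_mu.1 h))

theorem SyntacticReady.of_subst {T : SType Role Label Base Θ} {Θ₁ : Type u}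
    {σ : Θ → SType Role Label Base Θ₁} (h : SyntacticReady s p (T.subst σ)) :
    SyntacticReady s p T ∨ ∃ X, SyntacticReady s p (σ X) := by
  induction T generalizing Θ₁ with
  | fin => cases s <;> cases h
  | var X => exact .inr ⟨X, h⟩
  | send q I hI b T ih | recv q I hI b T ih =>
    simp only [subst, syntacticReady_send, syntacticReady_recv] at h ⊢
    obtain ⟨hs, h⟩ := h
    refine or_iff_not_imp_right.2 fun hσ => ⟨hs, h.imp_right fun h i => ?_⟩
    exact (ih i (h i)).resolve_right hσ
  | mu T ih =>
    rw [syntacticReady_mu]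
    refine (ih (syntacticReady_mu.1 h)).imp_right ?_
    rintro ⟨_ | X, hX⟩
    · exact absurd hX (not_syntacticReady_var _)
    · exact ⟨X, hX.of_rename⟩

theorem SyntacticReady.of_inst_mu {T : SType Role Label Base (Option Θ)}
    (h : SyntacticReady s p (T.inst (mu T))) : SyntacticReady s p (mu T) := by
  rcases h.of_subst with h | ⟨_ | X, hX⟩
  · exact syntacticReady_mu.2 h
  · exact hX
  · exact absurd hX (not_syntacticReady_var X)

theorem ReadyN.syntacticReady {T : SType Role Label Base Θ} (h : ReadyN s p n T) :
    SyntacticReady s p T := by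
  induction n generalizing T with
  | zero => exact h.elim
  | succ n ih =>
    obtain ⟨hT, h⟩ := h
    refine of_unfold (fun _ => SyntacticReady.of_inst_mu) ?_
    rw [head_eq_choice.1 hT]
    cases s with
    | send => exact syntacticReady_send.2 ⟨rfl, h.imp_right fun h i => ih (h i)⟩
    | recv => exact syntacticReady_recv.2 ⟨rfl, h.imp_right fun h i => ih (h i)⟩

theorem SyntacticReady.ready {T : SType Role Label Base Θ} (h : SyntacticReady s p T) :
    Ready s p T := by
  have ready_mu {Θ : Type u} {T : SType Role Label Base (Option Θ)} (h : Ready s p T) :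
      Ready s p (SType.mu T) := (h.subst _).congr (out_inst_mu T)
  cases s with
  | send =>
    induction (h : Sends p T) with
    | base I hI b T => exact .of_out rfl
    | send q I hI b T _ ih => exact .of_branches rfl ih
    | mu T _ ih => exact ready_mu ih
  | recv =>
    induction (h : Recvs p T) with
    | base I hI b T => exact .of_out rfl
    | recv q I hI b T _ ih => exact .of_branches rfl ih
    | mu T _ ih => exact ready_mu ih

theorem ready_iff_syntacticReady {T : SType Role Label Base Θ} :
    Ready s p T ↔ SyntacticReady s p T :=
  ⟨fun ⟨_, h⟩ => h.syntacticReady, SyntacticReady.ready⟩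

end Syntactic

theorem IsSimulation.orientedSub {R : SType Role Label Base Θ → SType Role Label Base Θ → Prop}
    (hR : IsSimulation R) {T U : SType Role Label Base Θ} (h : R T U) : OrientedSub .send T U := by
  let R' : Polarity → SType Role Label Base Θ → SType Role Label Base Θ → Prop
    | .send, T, U => R T U
    | .recv, T, U => R U T
  refine ⟨R', { symm := ?_, red := ?_, ready := ?_, var := ?_ }, h⟩
  · rintro (_ | _) T U h <;> exact h
  · rintro (_ | _) T U p I hI c V h hT i
    · obtain ⟨U', hU', h'⟩ := hR.left_send T U h p I hI c V (head_eq_choice.1 hT) i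
      exact ⟨U', red_iff_syntacticRed.2 hU', h'⟩
    · obtain ⟨U', hU', h'⟩ := hR.right_recv U T h p I hI c V (head_eq_choice.1 hT) i
      exact ⟨U', red_iff_syntacticRed.2 hU', h'⟩
  · rintro (_ | _) T U p I hI c V h hT <;> refine ready_iff_syntacticReady.2 ?_
    · exact hR.left_recv T U h p I hI c V (head_eq_choice.1 hT)
    · exact hR.right_send U T h p I hI c V (head_eq_choice.1 hT)
  · rintro (_ | _) T U X h hT <;> refine head_eq_var.2 ?_
    · exact (hR.vars T U h X).1 (head_eq_var.1 hT)
    · exact (hR.vars U T h X).2 (head_eq_var.1 hT)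

theorem isSimulation_orientedSub : IsSimulation fun T U : SType Role Label Base Θ =>
    T.WF ∧ U.WF ∧ OrientedSub .send T U where
  wf T U h := ⟨h.1, h.2.1⟩
  left_send := by
    rintro T U ⟨hT, hU, h⟩ p I hI c V hTV i
    have hout : T.out = .choice .send p I hI c V := head_eq_choice.2 hTV
    obtain ⟨U', hUU', h'⟩ := h.exists_red hout i
    exact ⟨U', red_iff_syntacticRed.1 hUU', hT.of_out hout i, hUU'.wf hU, h'⟩
  left_recv := by
    rintro T U ⟨-, -, h⟩ p I hI c V hTV
    exact ready_iff_syntacticReady.1 (h.ready (head_eq_choice.2 hTV))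
  right_send := by
    rintro T U ⟨-, -, h⟩ p I hI c V hUV
    exact ready_iff_syntacticReady.1 (h.ready_left (head_eq_choice.2 hUV))
  right_recv := by
    rintro T U ⟨hT, hU, h⟩ p I hI c V hUV i
    have hout : U.out = .choice .recv p I hI c V := head_eq_choice.2 hUV
    obtain ⟨T', hTT', h'⟩ := h.exists_red_dual hout i
    exact ⟨T', red_iff_syntacticRed.1 hTT', Red.wf hTT' hT, hU.of_out hout i, h'⟩
  vars := by
    rintro T U ⟨-, -, h⟩ X
    simp only [← head_eq_var]
    exact ⟨h.out_eq_var, (orientedSub_dual.2 h).out_eq_var⟩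

theorem sub_iff {T U : SType Role Label Base Θ} :
    T.Sub U ↔ T.WF ∧ U.WF ∧ OrientedSub .send T U :=
  ⟨fun ⟨_, hR, h⟩ => ⟨(hR.wf _ _ h).1, (hR.wf _ _ h).2, hR.orientedSub h⟩,
    fun h => ⟨_, isSimulation_orientedSub, h⟩⟩

section Sub

variable {S T U : SType Role Label Base Θ} {I J : Finset Label} {hI : I.Nonempty}
  {hJ : J.Nonempty}

theorem Sub.refl (hT : T.WF) : T.Sub T :=
  sub_iff.2 ⟨hT, hT, .refl _ T⟩

theorem Sub.trans (hST : S.Sub T) (hTU : T.Sub U) : S.Sub U := by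
  rw [sub_iff] at *
  exact ⟨hST.1, hTU.2.1, hST.2.2.trans hTU.2.2⟩

theorem Sub.send (p : Role) (hJI : J ⊆ I) (b : I → Base) {T : J → SType Role Label Base Θ}
    {U : I → SType Role Label Base Θ} (hU : ∀ i, (U i).WF)
    (h : ∀ i : J, (T i).Sub (U ⟨i, hJI i.2⟩)) :
    (SType.send p J hJ (fun i => b ⟨i, hJI i.2⟩) T).Sub (SType.send p I hI b U) := by
  simp only [sub_iff] at h
  exact sub_iff.2 ⟨fun i => (h i).1, hU, .choice .send p fun i => (h i).2.2⟩

theorem Sub.recv (p : Role) (hJI : J ⊆ I) (b : I → Base) {T : I → SType Role Label Base Θ}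
    {U : J → SType Role Label Base Θ} (hT : ∀ i, (T i).WF)
    (h : ∀ i : J, (T ⟨i, hJI i.2⟩).Sub (U i)) :
    (SType.recv p I hI b T).Sub (SType.recv p J hJ (fun i => b ⟨i, hJI i.2⟩) U) := by
  simp only [sub_iff] at h
  exact sub_iff.2 ⟨hT, fun i => (h i).2.1,
    orientedSub_dual.1 (.choice .recv p fun i => orientedSub_dual.2 (h i).2.2)⟩

theorem Sub.subst (h : S.Sub T) {σ τ : Θ → SType Role Label Base Θ₁}
    (hστ : ∀ X, (σ X).Sub (τ X)) : (S.subst σ).Sub (T.subst τ) := by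
  simp only [sub_iff] at h hστ ⊢
  exact ⟨h.1.subst fun X => (hστ X).1, h.2.1.subst fun X => (hστ X).2.1,
    h.2.2.subst fun X => (hστ X).2.2⟩

theorem Sub.rename (h : S.Sub T) (f : Θ → Θ₁) : (S.rename f).Sub (T.rename f) := by
  rw [rename_eq_subst, rename_eq_subst]
  exact h.subst fun X => .refl trivial

theorem Sub.mu {S T : SType Role Label Base (Option Θ)} (hS : (mu S).WF) (hT : (mu T).WF)
    (h : S.Sub T) : (mu S).Sub (mu T) :=
  sub_iff.2 ⟨hS, hT, (sub_iff.1 h).2.2.mu⟩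

end Sub

theorem Sub.muVar {V : Type u} {Θ : Set V} {X : V} {T U : SType Role Label Base ↥(insert X Θ)}
    (hT : (muVar X T).WF) (hU : (muVar X U).WF) (h : T.Sub U) : (muVar X T).Sub (muVar X U) :=
  .mu hT hU (h.rename _)

end SType

theorem mainTheorem8 {Role Label Base : Type v} {V : Type u} (Θ : Set V) :
    -- reflexivity
    (∀ T : SType Role Label Base ↥Θ, T.WF → T.Sub T) ∧
    -- transitivity
    (∀ S T U : SType Role Label Base ↥Θ, S.Sub T → T.Sub U → S.Sub U) ∧
    -- internal choice
    (∀ (p : Role) (I J : Finset Label) (hI : I.Nonempty) (hJ : J.Nonempty) (hJI : J ⊆ I)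
      (b : I → Base) (T : J → SType Role Label Base ↥Θ) (U : I → SType Role Label Base ↥Θ),
      (∀ i, (U i).WF) → (∀ i : J, (T i).Sub (U ⟨i, hJI i.2⟩)) →
      (SType.send p J hJ (fun i => b ⟨i, hJI i.2⟩) T).Sub (SType.send p I hI b U)) ∧
    -- external choice
    (∀ (p : Role) (I J : Finset Label) (hI : I.Nonempty) (hJ : J.Nonempty) (hJI : J ⊆ I)
      (b : I → Base) (T : I → SType Role Label Base ↥Θ) (U : J → SType Role Label Base ↥Θ),
      (∀ i, (T i).WF) → (∀ i : J, (T ⟨i, hJI i.2⟩).Sub (U i)) →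
      (SType.recv p I hI b T).Sub (SType.recv p J hJ (fun i => b ⟨i, hJI i.2⟩) U)) ∧
    -- recursion
    (∀ (X : V), X ∉ Θ → ∀ T U : SType Role Label Base ↥(insert X Θ),
      (SType.muVar X T).WF → (SType.muVar X U).WF → T.Sub U →
      (SType.muVar X T).Sub (SType.muVar X U)) ∧
    -- substitution, for variables from an arbitrary set
    (∀ (Ξ : Set V) (T U : SType Role Label Base ↥Ξ) (σ τ : ↥Ξ → SType Role Label Base ↥Θ),
      T.Sub U → (∀ X, (σ X).Sub (τ X)) → (T.subst σ).Sub (U.subst τ)) := by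
  exact ⟨fun _ => .refl, fun _ _ _ => .trans, fun p _ _ _ _ hJI b _ _ => .send p hJI b,
    fun p _ _ _ _ hJI b _ _ => .recv p hJI b, fun _ _ _ _ => .muVar, fun _ _ _ _ _ h => h.subst⟩
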